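/- A \emph{valuation distribution} $D$ is a Borel probability measure on $\mathbb R_+=[0,\infty)$. For a price $p\ge 0$ let $\mathrm{rev}_D(p)=p\cdot\Pr_{v\sim D}[v\ge p]$ and $\mathrm{opt}_D=\sup_{p\ge 0}\mathrm{rev}_D(p)$. A (possibly randomized) learning algorithm is a sequence $t=(t_n)_{n\in\mathbb N}$ of Markov kernels from $\mathbb R_+^n$ (samples) to $\mathbb R_+$ (prices), and its revenue gap under $D$ is $\epsilon_n(t,D)=\mathrm{opt}_D-\mathbb E[\mathrm{rev}_D(t_n(S))]$, the expectation being over $S\sim D^n$ and the internal randomness of $t_n$. A \emph{rate} is a non-increasing function $g:\mathbb N\to(0,1]$ with $g(n)\to 0$. A class $\mathbb D$ of valuation distributions is \emph{not universally learnable at a rate faster than} $R$ if for every algorithm $t$ there are a single $D\in\mathbb D$ and constants $C,c>0$ with $\epsilon_n(t,D)\ge C\,R(\lfloor cn\rfloor)$ for infinitely many $n$. We say that $t$ \emph{achieves an $o(n^{-1/2})$ rate on} $\mathbb D$ if for every $D\in\mathbb D$ there are a rate $g\in o(n^{-1/2})$ and a constant $C>0$, both allowed to depend on $D$, with $\epsilon_n(t,D)\le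 C\,g(n)$ for all $n$. The class $\mathbb D$ is \emph{universally learnable at an optimal $o(n^{-1/2})$ rate} if some algorithm achieves an $o(n^{-1/2})$ rate on $\mathbb D$ and, for every $R\in o(n^{-1/2})$, $\mathbb D$ is not universally learnable at a rate faster than $R$. \textbf{Theorem.} Let $\mathbb D$ be the class of all valuation distributions with bounded support. \begin{enumerate} \item $\mathbb D$ is universally learnable at an optimal $o(n^{-1/2})$ rate. \item The upper bound is attained by Empirical Revenue Maximization: ERM algorithms exist, and every algorithm that, given $S=(S_1,\dots,S_n)$, almost surely outputs a maximizer over $p\ge 0$ of the empirical revenue $p\cdot\frac1n\#\{i:S_i\ge p\}$ (for $n=0$, any price; ties broken arbitrarily, possibly at random) achieves an $o(n^{-1/2})$ rate on $\mathbb D$. \item Conversely, the hard distribution can be taken on $[0,1]$: for every $R:\mathbb N\to\mathbb R$ with $R\in o(n^{-1/2})$ and every algorithm $t$ there are a single valuation distribution $D$ on $[0,1]$ and constants $C,c>0$ such that $\epsilon_n(t,D)\ge C\,R(\lfloor cn\rfloor)$ for infinitely many $n$. \end{enumerate} -/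

import Mathlib

open MeasureTheory ProbabilityTheory Filter Asymptotics
open scoped NNReal Topology

noncomputable section

/-- A valuation distribution: a Borel probability measure on `[0, ∞)`. -/
abbrev ValuationDist := ProbabilityMeasure ℝ≥0

/-- A (possibly randomized) learning algorithm: for each sample size `n`, a Markov kernel from samples
`S ∈ [0, ∞)ⁿ` to prices in `[0, ∞)`. The law of the posted price given `S` is `kernel n S`. -/
structure PricingAlgorithm where
  kernel : (n : ℕ) → Kernel (Fin n → ℝ≥0) ℝ≥0
  isMarkov : ∀ n, IsMarkovKernel (kernel n)

/-- The revenue `p · Pr_{v ∼ D}[v ≥ p]` of the price `p` under `D`. -/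
def rev (D : ValuationDist) (p : ℝ≥0) : ℝ :=
  (p : ℝ) * (D : Measure ℝ≥0).real (Set.Ici p)

/-- The optimal revenue `sup_p rev D p`; it is used only for distributions of bounded support, for which
`rev D` is bounded. -/
def opt (D : ValuationDist) : ℝ := ⨆ p : ℝ≥0, rev D p

/-- The expected revenue of the algorithm on `n` i.i.d. samples, over the samples and its own randomness. -/
def expectedRev (t : PricingAlgorithm) (D : ValuationDist) (n : ℕ) : ℝ :=
  ∫ S, ∫ p, rev D p ∂(t.kernel n S) ∂(Measure.pi fun _ : Fin n => (D : Measure ℝ≥0))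

/-- The learning curve: the expected revenue gap `ε_n(t, D)`. -/
def revGap (t : PricingAlgorithm) (D : ValuationDist) (n : ℕ) : ℝ :=
  opt D - expectedRev t D n

/-- The distributions with bounded support. -/
def boundedSupport : Set ValuationDist :=
  {D | ∃ H : ℝ≥0, ∀ᵐ v ∂(D : Measure ℝ≥0), v ≤ H}

/-- The distributions on `[0, 1]`. -/
def onUnitInterval : Set ValuationDist :=
  {D | ∀ᵐ v ∂(D : Measure ℝ≥0), v ≤ 1}

/-- A rate function: `R : ℕ → (0, 1]` decreasing to `0`. -/
def IsRate (R : ℕ → ℝ) : Prop :=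
  (∀ n, 0 < R n ∧ R n ≤ 1) ∧ Antitone R ∧ Tendsto R atTop (𝓝 0)

/-- On every `D` in the class, the revenue gap of `t` is bounded by some rate in `o(R)`; the rate and the
constant may depend on `D`. -/
def AchievesLittleO (t : PricingAlgorithm) (𝔻 : Set ValuationDist) (R : ℕ → ℝ) : Prop :=
  ∀ D ∈ 𝔻, ∃ g : ℕ → ℝ, IsRate g ∧ g =o[atTop] R ∧ ∃ C : ℝ, 0 < C ∧ ∀ n : ℕ, revGap t D n ≤ C * g n

/-- The class is not universally learnable at a rate faster than `R`: every algorithm has, on a single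
distribution of the class, revenue gap at least `C · R(⌊c n⌋)` for infinitely many `n`. -/
def NotLearnableFasterThan (𝔻 : Set ValuationDist) (R : ℕ → ℝ) : Prop :=
  ∀ t : PricingAlgorithm, ∃ D ∈ 𝔻, ∃ C : ℝ, 0 < C ∧ ∃ c : ℝ, 0 < c ∧
    ∃ᶠ n : ℕ in atTop, C * R ⌊c * (n : ℝ)⌋₊ ≤ revGap t D n

/-- The class is universally learnable at an optimal `o(R)` rate. In the lower bound `g` ranges over all
real sequences in `o(R)`, not only the monotone ones with values in `(0, 1]`. -/
def LearnableAtOptimalLittleO (𝔻 : Set ValuationDist) (R : ℕ → ℝ) : Prop :=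
  (∃ t : PricingAlgorithm, AchievesLittleO t 𝔻 R) ∧
    ∀ g : ℕ → ℝ, g =o[atTop] R → NotLearnableFasterThan 𝔻 g

/-- The revenue `p · #{i | S i ≥ p} / n` of the price `p` under the empirical distribution of `S`. -/
def empiricalRev {n : ℕ} (S : Fin n → ℝ≥0) (p : ℝ≥0) : ℝ :=
  (p : ℝ) * ((Finset.univ.filter fun i => p ≤ S i).card / (n : ℝ))

/-- Empirical revenue maximization: the posted price always maximizes the empirical revenue, with an
arbitrary (possibly randomized) choice among the maximizers. -/
def IsERM (t : PricingAlgorithm) : Prop :=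
  ∀ (n : ℕ) (S : Fin n → ℝ≥0), ∀ᵐ p ∂(t.kernel n S), ∀ q : ℝ≥0, empiricalRev S q ≤ empiricalRev S p

/-- The rate `n ^ (-1/2)`. -/
def invSqrt (n : ℕ) : ℝ := (n : ℝ) ^ (-(1 / 2) : ℝ)

end

/-! Upper bound. Empirical and true revenue at `p` differ by `p / n` times the centred number of
samples above `p`, so everything rests on this empirical process. Cut `[0, H]` at finitely many
points into cells of small mass and length. As the cells are finitely many, some `η > 0`,
independent of `n`, separates them: on each cell the revenue either has supremum `opt` or stays `η`
below it. If the empirical maximizer lies in a cell of the first kind, it is compared with a nearly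
optimal price of the same cell, and its loss is at most the oscillation of the process inside the
cell. Otherwise the loss `g` is at least `η`, so `g ≤ g ^ 2 / η`, which has expectation `O(1 / n)`
(`exists_erm_gap_le`).

The oscillation inside cells is small compared with `√n` because of fourth moments. Along an
increasing chain `A k` the deviation divided by `1 - μ (A k)` is a martingale, so a Doob argument
bounds its maximum over a cell of mass `μ_j` by the fourth moment at the end of the chain, of order
`n μ_j + (n μ_j) ^ 2` (`first_crossing_le`). Summed over cells of mass at most `ε` this is `n + ε n
^ 2` up to constants (`integral_cellDeviation_sq_le`). Hence the expected loss is at most `C ω / √n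
+ K / n` with `ω` arbitrarily small and `K` depending on `ω` (`erm_revGap_le`), which is `o(1 /
√n)`.

Lower bound. Suppose the revenue curve is constant and maximal on an interval. A density
perturbation of order `1 / √n` raises or lowers revenue on part of that interval; `n` samples cannot
tell the two signs apart, and no price is good for both, so any algorithm loses order `1 / √n` on
one of them (`exists_hard_perturbation`). Both perturbed distributions again have an optimal
plateau, so the construction can be repeated at larger `n`. For fixed `n` the loss is Lipschitz in
the density (`revGap_tilt_le`), so it persists on a small ball of densities. Nested balls, as in
Baire's theorem, give one limit density that is hard at infinitely many `n`. -/

/-! ### Moments of the centred empirical measure -/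

section EmpiricalProcess

variable {α : Type*} [MeasurableSpace α]

/-- A factor vanishing on `A` with mean zero is orthogonal to every function that does not distinguish
between the values of the `i`-th sample off `A`. -/
lemma integral_mul_eq_zero_of_vanish {n : ℕ} (μ : Measure α) [IsProbabilityMeasure μ] (i : Fin n)
    {Z : (Fin n → α) → ℝ} (hZ : Measurable Z) {h : α → ℝ} (hh : Measurable h)
    (h0 : ∫ v, h v ∂μ = 0) {A : Set α} (hA : ∀ v ∈ A, h v = 0)
    (hinv : ∀ S S' : Fin n → α, (∀ j, j ≠ i → S j = S' j) → S i ∉ A → S' i ∉ A → Z S = Z S') :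
    ∫ S, Z S * h (S i) ∂(Measure.pi fun _ : Fin n => μ) = 0 := by
  classical
  by_cases hne : ∃ v0, v0 ∉ A
  swap
  · push Not at hne
    have : ∀ v, h v = 0 := fun v => hA v (hne v)
    simp [this]
  obtain ⟨v0, hv0⟩ := hne
  -- Where `h (S i)` is nonzero the `i`-th sample is off `A`, so freezing it at `v0` does not change
  -- `Z`. The frozen `Z` depends on the other samples only and is independent of `h (S i)`.
  have hupd : ∀ S : Fin n → α, Z S * h (S i) = Z (Function.update S i v0) * h (S i) := by
    intro S
    by_cases hS : S i ∈ A
    · simp [hA _ hS]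
    · rw [hinv S (Function.update S i v0) (fun j hj => by simp [hj]) hS (by simpa using hv0)]
  simp_rw [hupd]
  have hind : iIndepFun (fun (j : Fin n) (S : Fin n → α) => S j) (Measure.pi fun _ : Fin n => μ) :=
    iIndepFun_pi (X := fun _ : Fin n => (id : α → α)) (fun _ => aemeasurable_id)
  have h2 := hind.indepFun_finset {i} (Finset.univ.erase i) (by simp) (fun j => measurable_pi_apply j)
  let φ : ({x // x ∈ Finset.univ.erase i} → α) → ℝ :=
    fun u => Z (fun j => if hj : j = i then v0 else u ⟨j, by simp [hj]⟩)
  let ψ : (({i} : Finset (Fin n)) → α) → ℝ := fun u => h (u ⟨i, by simp⟩)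
  have hφ : Measurable φ := by
    refine hZ.comp (measurable_pi_lambda _ fun j => ?_)
    by_cases hj : j = i
    · simp [hj]
    · simp only [hj, dite_false]; exact measurable_pi_apply _
  have hψ : Measurable ψ := hh.comp (measurable_pi_apply _)
  have h3 := h2.comp hψ hφ
  have e1 : (φ ∘ fun (S : Fin n → α) (j : {x // x ∈ Finset.univ.erase i}) => S j)
      = fun S => Z (Function.update S i v0) := by
    funext S
    simp only [φ, Function.comp]
    congr 1
    funext j
    by_cases hj : j = i
    · subst hj; simp
    · simp [hj]
  have e2 : (ψ ∘ fun (S : Fin n → α) (j : ({i} : Finset (Fin n))) => S j) = fun S => h (S i) := rfl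
  rw [e1, e2] at h3
  have hm1 : Measurable fun S : Fin n → α => h (S i) := hh.comp (measurable_pi_apply i)
  have hm2 : Measurable fun S : Fin n → α => Z (Function.update S i v0) :=
    hZ.comp (measurable_pi_lambda _ fun j => by
      by_cases hj : j = i
      · subst hj; simp
      · simp only [Function.update_of_ne hj]; exact measurable_pi_apply _)
  have h4 := h3.integral_fun_mul_eq_mul_integral hm1.aestronglyMeasurable hm2.aestronglyMeasurable
  have h5 : ∫ S, h (S i) ∂(Measure.pi fun _ : Fin n => μ) = 0 := by
    rw [integral_comp_eval (μ := fun _ : Fin n => μ) (f := h) hh.aestronglyMeasurable, h0]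
  simp_rw [mul_comm (Z _)]
  rw [h4, h5, zero_mul]

/-- The centred number of samples in `A`. -/
noncomputable def deviation (μ : Measure α) {n : ℕ} (A : Set α) (S : Fin n → α) : ℝ :=
  ∑ i, (A.indicator (fun _ => (1 : ℝ)) (S i) - μ.real A)

lemma measurable_deviation (μ : Measure α) {n : ℕ} {A : Set α} (hA : MeasurableSet A) :
    Measurable (deviation μ A : (Fin n → α) → ℝ) := by
  unfold deviation
  refine Finset.measurable_sum _ fun i _ => ?_
  exact ((measurable_const.indicator hA).comp (measurable_pi_apply i)).sub_const _

lemma abs_deviation_le (μ : Measure α) [IsProbabilityMeasure μ] {n : ℕ} (A : Set α)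
    (S : Fin n → α) : |deviation μ A S| ≤ n := by
  unfold deviation
  refine (Finset.abs_sum_le_sum_abs _ _).trans ?_
  have : ∀ i ∈ (Finset.univ : Finset (Fin n)),
      |A.indicator (fun _ => (1 : ℝ)) (S i) - μ.real A| ≤ 1 := by
    intro i _
    have h1 : μ.real A ≤ 1 := measureReal_le_one
    have h2 : 0 ≤ μ.real A := measureReal_nonneg
    by_cases h : S i ∈ A
    · simp only [h, Set.indicator_of_mem]; rw [abs_le]; constructor <;> linarith
    · simp only [h, not_false_eq_true, Set.indicator_of_notMem]; rw [abs_le]; constructor <;> linarith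
  calc _ ≤ ∑ i : Fin n, (1 : ℝ) := Finset.sum_le_sum this
    _ = n := by simp

lemma integrable_of_bounded {β : Type*} [MeasurableSpace β] {ν : Measure β} [IsFiniteMeasure ν]
    {f : β → ℝ} (hf : Measurable f) (C : ℝ) (hC : ∀ x, |f x| ≤ C) : Integrable f ν :=
  Integrable.of_bound hf.aestronglyMeasurable C (Eventually.of_forall fun x => by
    simpa [Real.norm_eq_abs] using hC x)

/-- Second and fourth moments of a sum of independent centred variables bounded by `1`. -/
lemma moments_sum_le {Ω ι : Type*} [MeasurableSpace Ω] [DecidableEq ι] {P : Measure Ω}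
    [IsProbabilityMeasure P] {X : ι → Ω → ℝ} (hind : iIndepFun X P) (hX : ∀ i, Measurable (X i))
    (hb : ∀ i ω, |X i ω| ≤ 1) (h0 : ∀ i, ∫ ω, X i ω ∂P = 0) {m : ℝ}
    (h2 : ∀ i, ∫ ω, X i ω ^ 2 ∂P ≤ m) (s : Finset ι) :
    ∫ ω, (∑ i ∈ s, X i ω) ^ 2 ∂P ≤ s.card * m ∧
      ∫ ω, (∑ i ∈ s, X i ω) ^ 4 ∂P ≤ s.card * m + 3 * (s.card * m) ^ 2 := by
  induction s using Finset.induction_on with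
  | empty => simp
  | insert a s ha ih =>
    obtain ⟨ih2, ih4⟩ := ih
    have hmeas : Measurable fun ω => ∑ i ∈ s, X i ω := Finset.measurable_sum _ fun i _ => hX i
    have hYb : ∀ ω, |∑ i ∈ s, X i ω| ≤ s.card := fun ω => by
      refine (Finset.abs_sum_le_sum_abs _ _).trans ?_
      calc _ ≤ ∑ i ∈ s, (1 : ℝ) := Finset.sum_le_sum fun i _ => hb i ω
        _ = _ := by simp
    set Y : Ω → ℝ := fun ω => ∑ i ∈ s, X i ω with hY
    have hI : IndepFun Y (X a) P := by
      have := hind.indepFun_finsetSum_of_notMem hX ha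
      convert this using 1
      funext ω; simp [hY]
    have hint : ∀ k l : ℕ, Integrable (fun ω => Y ω ^ k * X a ω ^ l) P := fun k l =>
      integrable_of_bounded ((hmeas.pow_const k).mul ((hX a).pow_const l)) ((s.card : ℝ) ^ k)
        fun ω => by
          rw [abs_mul, abs_pow, abs_pow]
          calc _ ≤ (s.card : ℝ) ^ k * 1 ^ l := by
                gcongr
                · exact hYb ω
                · exact hb a ω
            _ = _ := by simp
    have hprod : ∀ k l : ℕ, ∫ ω, Y ω ^ k * X a ω ^ l ∂P
        = (∫ ω, Y ω ^ k ∂P) * ∫ ω, X a ω ^ l ∂P := fun k l =>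
      (hI.comp (measurable_id.pow_const k) (measurable_id.pow_const l)).integral_fun_mul_eq_mul_integral
        (hmeas.pow_const k).aestronglyMeasurable ((hX a).pow_const l).aestronglyMeasurable
    have hY0 : ∫ ω, Y ω ^ 1 ∂P = 0 := by
      simp only [hY, pow_one]
      rw [integral_finsetSum _ fun i _ => integrable_of_bounded (hX i) 1 (hb i)]
      simp [h0]
    have hX1 : ∫ ω, X a ω ^ 1 ∂P = 0 := by simpa using h0 a
    have hX4 : ∫ ω, X a ω ^ 4 ∂P ≤ ∫ ω, X a ω ^ 2 ∂P := by
      refine integral_mono (by simpa using hint 0 4) (by simpa using hint 0 2) fun ω => ?_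
      have := hb a ω
      have h1 : X a ω ^ 2 ≤ 1 := by rw [← sq_abs]; exact pow_le_one₀ (abs_nonneg _) this
      nlinarith [sq_nonneg (X a ω)]
    have hX2n : 0 ≤ ∫ ω, X a ω ^ 2 ∂P := integral_nonneg fun ω => sq_nonneg _
    have hY2n : 0 ≤ ∫ ω, Y ω ^ 2 ∂P := integral_nonneg fun ω => sq_nonneg _
    have e2 : ∫ ω, (X a ω + Y ω) ^ 2 ∂P = ∫ ω, X a ω ^ 2 ∂P + ∫ ω, Y ω ^ 2 ∂P := by
      have : ∀ ω, (X a ω + Y ω) ^ 2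
          = Y ω ^ 0 * X a ω ^ 2 + 2 * (Y ω ^ 1 * X a ω ^ 1) + Y ω ^ 2 * X a ω ^ 0 := fun ω => by ring
      simp_rw [this]
      rw [integral_add ((hint _ _).fun_add ((hint _ _).const_mul _)) (hint _ _),
        integral_add (hint _ _) ((hint _ _).const_mul _), integral_const_mul, hprod 1 1, hX1]
      simp
    have e4 : ∫ ω, (X a ω + Y ω) ^ 4 ∂P = ∫ ω, X a ω ^ 4 ∂P
        + 6 * ((∫ ω, Y ω ^ 2 ∂P) * ∫ ω, X a ω ^ 2 ∂P) + ∫ ω, Y ω ^ 4 ∂P := by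
      have : ∀ ω, (X a ω + Y ω) ^ 4
          = Y ω ^ 0 * X a ω ^ 4 + 4 * (Y ω ^ 1 * X a ω ^ 3) + 6 * (Y ω ^ 2 * X a ω ^ 2)
            + 4 * (Y ω ^ 3 * X a ω ^ 1) + Y ω ^ 4 * X a ω ^ 0 := fun ω => by ring
      simp_rw [this]
      rw [integral_add ((((hint _ _).fun_add ((hint _ _).const_mul _)).fun_add ((hint _ _).const_mul _)).fun_add
          ((hint _ _).const_mul _)) (hint _ _),
        integral_add (((hint _ _).fun_add ((hint _ _).const_mul _)).fun_add ((hint _ _).const_mul _))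
          ((hint _ _).const_mul _),
        integral_add ((hint _ _).fun_add ((hint _ _).const_mul _)) ((hint _ _).const_mul _),
        integral_add (hint _ _) ((hint _ _).const_mul _), integral_const_mul, integral_const_mul,
        integral_const_mul, hprod 1 3, hprod 3 1, hprod 2 2, hX1, hY0]
      simp
    have hm := h2 a
    simp_rw [Finset.sum_insert ha, Finset.card_insert_of_notMem ha]
    push_cast
    change ∫ ω, (X a ω + Y ω) ^ 2 ∂P ≤ _ ∧ ∫ ω, (X a ω + Y ω) ^ 4 ∂P ≤ _
    rw [e2, e4]
    have hc : (0 : ℝ) ≤ s.card := Nat.cast_nonneg _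
    refine ⟨by linarith, ?_⟩
    have hmul : (∫ ω, Y ω ^ 2 ∂P) * ∫ ω, X a ω ^ 2 ∂P ≤ (s.card * m) * m :=
      mul_le_mul ih2 hm hX2n (hY2n.trans ih2)
    -- With `c` terms already summed, the new one adds at most `m + 6 c m²`, while `3 ((c + 1) m)²`
    -- exceeds `3 (c m)²` by `6 c m² + 3 m²`.
    nlinarith [sq_nonneg m]

/-- The variance of an indicator is at most the mass of its set. Keeping this mass, rather than
bounding it by `1`, is what makes light cells contribute little. -/
lemma integral_deviation_pow_le (μ : Measure α) [IsProbabilityMeasure μ] (n : ℕ) {A : Set α}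
    (hA : MeasurableSet A) :
    ∫ S, deviation μ A S ^ 2 ∂(Measure.pi fun _ : Fin n => μ) ≤ n * μ.real A ∧
      ∫ S, deviation μ A S ^ 4 ∂(Measure.pi fun _ : Fin n => μ)
        ≤ n * μ.real A + 3 * (n * μ.real A) ^ 2 := by
  set h : α → ℝ := fun v => A.indicator (fun _ => (1 : ℝ)) v - μ.real A with hh
  have hm : Measurable h := (measurable_const.indicator hA).sub_const _
  have h1 : μ.real A ≤ 1 := measureReal_le_one
  have h2 : 0 ≤ μ.real A := measureReal_nonneg
  have hb : ∀ v, |h v| ≤ 1 := by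
    intro v
    by_cases hv : v ∈ A
    · simp only [hh, hv, Set.indicator_of_mem]; rw [abs_le]; constructor <;> linarith
    · simp only [hh, hv, not_false_eq_true, Set.indicator_of_notMem]; rw [abs_le]
      constructor <;> linarith
  have hind : iIndepFun (fun (j : Fin n) (S : Fin n → α) => h (S j))
      (Measure.pi fun _ : Fin n => μ) :=
    iIndepFun_pi (X := fun _ : Fin n => h) (fun _ => hm.aemeasurable)
  have hmap : ∀ (i : Fin n) (f : α → ℝ), Measurable f →
      ∫ S, f (S i) ∂(Measure.pi fun _ : Fin n => μ) = ∫ v, f v ∂μ := by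
    intro i f hf
    exact integral_comp_eval (μ := fun _ : Fin n => μ) (f := f) hf.aestronglyMeasurable
  have hi1 : Integrable (A.indicator (fun _ => (1 : ℝ))) μ := (integrable_const 1).indicator hA
  have i1 : ∫ v, A.indicator (fun _ => (1 : ℝ)) v ∂μ = μ.real A := by
    rw [integral_indicator hA]; simp
  have i0 : ∫ v, h v ∂μ = 0 := by
    simp only [hh]; rw [integral_sub hi1 (integrable_const _), i1]; simp
  have i2 : ∫ v, h v ^ 2 ∂μ ≤ μ.real A := by
    have : ∀ v, h v ^ 2 = A.indicator (fun _ => (1 : ℝ)) v * (1 - 2 * μ.real A) + μ.real A ^ 2 := by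
      intro v
      by_cases hv : v ∈ A
      · simp [hh, hv]; ring
      · simp [hh, hv]
    simp_rw [this]
    rw [integral_add (hi1.mul_const _) (integrable_const _), integral_mul_const, i1]
    simp
    nlinarith
  have := (moments_sum_le hind (fun i => hm.comp (measurable_pi_apply i)) (fun i S => hb _)
    (fun i => by rw [hmap i h hm, i0]) (m := μ.real A)
    (fun i => by rw [hmap i (fun v => h v ^ 2) (hm.pow_const 2)]; exact i2) Finset.univ)
  simpa [deviation, hh] using this

lemma integral_deviation_sq_le (μ : Measure α) [IsProbabilityMeasure μ] (n : ℕ) {A : Set α}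
    (hA : MeasurableSet A) :
    ∫ S, deviation μ A S ^ 2 ∂(Measure.pi fun _ : Fin n => μ) ≤ n :=
  (integral_deviation_pow_le μ n hA).1.trans
    (mul_le_of_le_one_right (Nat.cast_nonneg n) measureReal_le_one)

end EmpiricalProcess

/-! ### A Doob inequality along chains of sets -/

section MaximalInequality

variable {α : Type*} [MeasurableSpace α]

/-- The samples for which `A k` is the first member of the chain, among those indexed by `T`, whose
deviation reaches `x`. -/
def firstCrossing {ι : Type*} [LinearOrder ι] (μ : Measure α) (n : ℕ) (A : ι → Set α) (T : Finset ι)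
    (x : ℝ) (k : ι) : Set (Fin n → α) :=
  {S | x ≤ |deviation μ (A k) S| ∧ ∀ j ∈ T, j < k → |deviation μ (A j) S| < x}

lemma measurableSet_firstCrossing {ι : Type*} [LinearOrder ι] (μ : Measure α) (n : ℕ)
    {A : ι → Set α} (hA : ∀ k, MeasurableSet (A k)) (T : Finset ι) (x : ℝ) (k : ι) :
    MeasurableSet (firstCrossing μ n A T x k) := by
  have hdm : ∀ j, Measurable (deviation μ (A j) : (Fin n → α) → ℝ) := fun j =>
    measurable_deviation μ (hA j)
  have : firstCrossing μ n A T x k = {S | x ≤ |deviation μ (A k) S|} ∩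
      ⋂ j ∈ T, ⋂ _ : j < k, {S | |deviation μ (A j) S| < x} := by
    ext S; simp [firstCrossing]
  rw [this]
  refine (measurableSet_le measurable_const (hdm k).abs).inter ?_
  refine Finset.measurableSet_biInter _ fun j _ => MeasurableSet.iInter fun _ => ?_
  exact measurableSet_lt (hdm j).abs measurable_const

/-- Doob's fourth moment estimate on the event that the chain `A` first deviates at `k`. -/
lemma first_crossing_le {ι : Type*} [LinearOrder ι] (μ : Measure α) [IsProbabilityMeasure μ] (n : ℕ)
    {A : ι → Set α} (hA : ∀ k, MeasurableSet (A k)) (hmono : Monotone A) {B : Set α}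
    (hB : MeasurableSet B) (hAB : ∀ k, A k ⊆ B) (hhalf : μ.real B ≤ 1 / 2) (T : Finset ι) {x : ℝ}
    (hx : 0 ≤ x) (k : ι) :
    x ^ 4 * (Measure.pi fun _ : Fin n => μ).real (firstCrossing μ n A T x k)
      ≤ 16 * ∫ S in firstCrossing μ n A T x k, deviation μ B S ^ 4 ∂(Measure.pi fun _ : Fin n => μ) := by
  set E := firstCrossing μ n A T x k 
  set P := Measure.pi fun _ : Fin n => μ
  have hdm : ∀ j, Measurable (deviation μ (A j) : (Fin n → α) → ℝ) := fun j =>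
    measurable_deviation μ (hA j)
  have hBm : Measurable (deviation μ B : (Fin n → α) → ℝ) := measurable_deviation μ hB
  have hE : MeasurableSet E := measurableSet_firstCrossing μ n hA T x k
  -- This ratio makes `h` vanish on `A k`, expressing that the deviation over `1 - μ (A k)` is a
  -- martingale along the chain. The bound `c ≤ 2` is where mass at most one half is needed.
  set c : ℝ := (1 - μ.real (A k)) / (1 - μ.real B) with hc
  have hmk : μ.real (A k) ≤ μ.real B := measureReal_mono (hAB k)
  have hmk0 : 0 ≤ μ.real (A k) := measureReal_nonneg
  have hc0 : 0 ≤ c := by apply div_nonneg <;> linarith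
  have hc2 : c ≤ 2 := by rw [hc, div_le_iff₀ (by linarith)]; linarith
  set h : α → ℝ := fun v => c * (B.indicator (fun _ => (1 : ℝ)) v - μ.real B)
    - ((A k).indicator (fun _ => (1 : ℝ)) v - μ.real (A k)) with hh
  have hhm : Measurable h := (((measurable_const.indicator hB).sub_const _).const_mul _).sub
    ((measurable_const.indicator (hA k)).sub_const _)
  have hcent : ∀ C : Set α, MeasurableSet C →
      ∫ v, (C.indicator (fun _ => (1 : ℝ)) v - μ.real C) ∂μ = 0 := fun C hC => by
    rw [integral_sub ((integrable_const 1).indicator hC) (integrable_const _), integral_indicator hC]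
    simp
  have hcint : ∀ C : Set α, MeasurableSet C →
      Integrable (fun v => C.indicator (fun _ => (1 : ℝ)) v - μ.real C) μ := fun C hC =>
    ((integrable_const 1).indicator hC).sub (integrable_const _)
  have hh0 : ∫ v, h v ∂μ = 0 := by
    simp only [hh]
    rw [integral_sub ((hcint B hB).const_mul c) (hcint _ (hA k)), integral_const_mul, hcent B hB,
      hcent _ (hA k)]
    simp
  have hvan : ∀ v ∈ A k, h v = 0 := by
    intro v hv
    have hne : (1 - μ.real B) ≠ 0 := by linarith
    simp only [hh, hv, hAB k hv, Set.indicator_of_mem]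
    rw [hc, div_mul_cancel₀ _ hne]; ring
  -- Both the event `E` and the deviation at `k` are unaffected by moving a sample within the
  -- complement of `A k`, because the earlier sets of the chain lie in `A k`. So `Z` is orthogonal
  -- to the later increment.
  set Z : (Fin n → α) → ℝ := E.indicator fun S => deviation μ (A k) S ^ 3 with hZ
  have hZm : Measurable Z := ((hdm k).pow_const 3).indicator hE
  have hdevinv : ∀ j, j ≤ k → ∀ (i : Fin n) (S S' : Fin n → α), (∀ l, l ≠ i → S l = S' l) →
      S i ∉ A k → S' i ∉ A k → deviation μ (A j) S = deviation μ (A j) S' := by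
    intro j hj i S S' hS h1 h2
    unfold deviation
    refine Finset.sum_congr rfl fun l _ => ?_
    by_cases hl : l = i
    · subst hl
      rw [Set.indicator_of_notMem fun hm => h1 (hmono hj hm),
        Set.indicator_of_notMem fun hm => h2 (hmono hj hm)]
    · rw [hS l hl]
  have hZinv : ∀ (i : Fin n) (S S' : Fin n → α), (∀ l, l ≠ i → S l = S' l) →
      S i ∉ A k → S' i ∉ A k → Z S = Z S' := by
    intro i S S' hS h1 h2
    have hEE : S ∈ E ↔ S' ∈ E := by
      simp only [E, firstCrossing, Set.mem_ofPred_eq]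
      rw [hdevinv k le_rfl i S S' hS h1 h2]
      refine and_congr_right fun _ => forall_congr' fun j => forall_congr' fun _ =>
        forall_congr' fun hj => ?_
      rw [hdevinv j hj.le i S S' hS h1 h2]
    by_cases hm : S ∈ E
    · rw [hZ, Set.indicator_of_mem hm, Set.indicator_of_mem (hEE.1 hm),
        hdevinv k le_rfl i S S' hS h1 h2]
    · rw [hZ, Set.indicator_of_notMem hm, Set.indicator_of_notMem fun h' => hm (hEE.2 h')]
  have hZb : ∀ S, |Z S| ≤ (n : ℝ) ^ 3 := fun S => by
    rw [hZ]
    by_cases hm : S ∈ E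
    · rw [Set.indicator_of_mem hm, abs_pow]
      exact pow_le_pow_left₀ (abs_nonneg _) (abs_deviation_le μ _ _) 3
    · rw [Set.indicator_of_notMem hm, abs_zero]; positivity
  have hhb : ∃ K, ∀ v, |h v| ≤ K := by
    refine ⟨2 * 1 + 1, fun v => ?_⟩
    have hone : ∀ C : Set α, |C.indicator (fun _ => (1 : ℝ)) v - μ.real C| ≤ 1 := fun C => by
      simpa [deviation] using abs_deviation_le μ C (fun _ : Fin 1 => v)
    refine (abs_sub _ _).trans ?_
    rw [abs_mul, abs_of_nonneg hc0]
    gcongr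
    · exact hone B
    · exact hone _
  obtain ⟨K, hK⟩ := hhb
  have hdiff : ∀ S : Fin n → α, c * deviation μ B S - deviation μ (A k) S = ∑ i, h (S i) := by
    intro S
    simp only [deviation, hh, Finset.mul_sum, ← Finset.sum_sub_distrib]
  have horth : ∫ S, Z S * (c * deviation μ B S - deviation μ (A k) S) ∂P = 0 := by
    simp_rw [hdiff, Finset.mul_sum]
    rw [integral_finsetSum]
    · exact Finset.sum_eq_zero fun i _ =>
        integral_mul_eq_zero_of_vanish μ i hZm hhm hh0 hvan (hZinv i)
    · intro i _
      refine integrable_of_bounded (hZm.mul (hhm.comp (measurable_pi_apply i))) ((n : ℝ) ^ 3 * K)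
        fun S => ?_
      rw [abs_mul]
      exact mul_le_mul (hZb S) (hK _) (abs_nonneg _) (by positivity)
  have hBint : Integrable (fun S => deviation μ B S ^ 4) P :=
    integrable_of_bounded (hBm.pow_const 4) ((n : ℝ) ^ 4) fun S => by
      rw [abs_pow]; exact pow_le_pow_left₀ (abs_nonneg _) (abs_deviation_le μ _ _) 4
  have hZint : Integrable (fun S => Z S * (c * deviation μ B S - deviation μ (A k) S)) P := by
    refine integrable_of_bounded (hZm.mul ((hBm.const_mul c).sub (hdm k))) ((n : ℝ) ^ 3 * (2 * n + n))
      fun S => ?_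
    rw [abs_mul]
    refine mul_le_mul (hZb S) ((abs_sub _ _).trans ?_) (abs_nonneg _) (by positivity)
    rw [abs_mul, abs_of_nonneg hc0]
    gcongr
    · exact abs_deviation_le μ _ _
    · exact abs_deviation_le μ _ _
  -- Convexity of the fourth power: the tangent at `X` gives `X⁴ + 4 X³ (c Y - X) ≤ (c Y)⁴`, and the
  -- linear term integrates to zero by `horth`.
  have hpt : ∀ S, E.indicator (fun _ => x ^ 4) S + 4 * (Z S * (c * deviation μ B S
      - deviation μ (A k) S)) ≤ 16 * E.indicator (fun S => deviation μ B S ^ 4) S := by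
    intro S
    by_cases hm : S ∈ E
    · rw [hZ, Set.indicator_of_mem hm, Set.indicator_of_mem hm, Set.indicator_of_mem hm]
      set X := deviation μ (A k) S
      set Y := deviation μ B S
      have h1 : x ^ 4 ≤ X ^ 4 := by
        have := pow_le_pow_left₀ hx hm.1 4
        rwa [Even.pow_abs (by decide)] at this
      have h2 : X ^ 4 + 4 * (X ^ 3 * (c * Y - X)) ≤ (c * Y) ^ 4 := by
        nlinarith [sq_nonneg ((c * Y) ^ 2 - X ^ 2), sq_nonneg ((c * Y - X) * X),
          sq_nonneg (X * (c * Y - X))]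
      have h3 : (c * Y) ^ 4 ≤ 16 * Y ^ 4 := by
        rw [mul_pow]
        have : c ^ 4 ≤ 2 ^ 4 := pow_le_pow_left₀ hc0 hc2 4
        have hY : 0 ≤ Y ^ 4 := by positivity
        nlinarith
      linarith
    · rw [hZ, Set.indicator_of_notMem hm, Set.indicator_of_notMem hm, Set.indicator_of_notMem hm]
      simp
  have := integral_mono (((integrable_const (x ^ 4)).indicator hE).fun_add (hZint.const_mul 4))
    ((hBint.indicator hE).const_mul 16) hpt
  rw [integral_add ((integrable_const (x ^ 4)).indicator hE) (hZint.const_mul 4),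
    integral_const_mul, integral_const_mul, horth, integral_indicator hE, integral_indicator hE] at this
  simpa [mul_comm] using this

/-- A maximal inequality for the empirical process along a chain of sets inside a set of measure at
most one half. -/
lemma measure_exists_deviation_le {ι : Type*} [LinearOrder ι] (μ : Measure α) [IsProbabilityMeasure μ]
    (n : ℕ) {A : ι → Set α} (hA : ∀ k, MeasurableSet (A k)) (hmono : Monotone A) {B : Set α}
    (hB : MeasurableSet B) (hAB : ∀ k, A k ⊆ B) (hhalf : μ.real B ≤ 1 / 2) (T : Finset ι) {x : ℝ}
    (hx : 0 ≤ x) :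
    x ^ 4 * (Measure.pi fun _ : Fin n => μ).real {S | ∃ k ∈ T, x ≤ |deviation μ (A k) S|}
      ≤ 16 * (n * μ.real B + 3 * (n * μ.real B) ^ 2) := by
  set P := Measure.pi fun _ : Fin n => μ
  let E : ι → Set (Fin n → α) := firstCrossing μ n A T x
  have hE : ∀ k, MeasurableSet (E k) := measurableSet_firstCrossing μ n hA T x
  have hsub : {S : Fin n → α | ∃ k ∈ T, x ≤ |deviation μ (A k) S|} ⊆ ⋃ k ∈ T, E k := by
    rintro S ⟨k, hk, hkx⟩
    classical
    let T' := T.filter fun k => x ≤ |deviation μ (A k) S|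
    have hne : T'.Nonempty := ⟨k, by simp [T', hk, hkx]⟩
    have hmin := T'.min'_mem hne
    simp only [T', Finset.mem_filter] at hmin
    refine Set.mem_iUnion₂.2 ⟨T'.min' hne, hmin.1, hmin.2, fun j hj hlt => ?_⟩
    by_contra hcon
    exact absurd (T'.min'_le j (by simp [T', hj, not_lt.1 hcon])) (not_le.2 hlt)
  have hdisj : Set.PairwiseDisjoint (T : Set ι) E := by
    intro k hk l hl hkl
    refine Set.disjoint_left.2 fun S h1 h2 => ?_
    rcases lt_or_gt_of_ne hkl with h | h
    · exact absurd h1.1 (not_le.2 (h2.2 k hk h))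
    · exact absurd h2.1 (not_le.2 (h1.2 l hl h))
  have hBint : Integrable (fun S => deviation μ B S ^ 4) P :=
    integrable_of_bounded ((measurable_deviation μ hB).pow_const 4) ((n : ℝ) ^ 4) fun S => by
      rw [abs_pow]; exact pow_le_pow_left₀ (abs_nonneg _) (abs_deviation_le μ _ _) 4
  calc _ ≤ x ^ 4 * P.real (⋃ k ∈ T, E k) := by gcongr; exact measure_ne_top _ _
    _ ≤ x ^ 4 * ∑ k ∈ T, P.real (E k) := by gcongr; exact measureReal_biUnion_finset_le _ _
    _ = ∑ k ∈ T, x ^ 4 * P.real (E k) := Finset.mul_sum _ _ _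
    _ ≤ ∑ k ∈ T, 16 * ∫ S in E k, deviation μ B S ^ 4 ∂P := Finset.sum_le_sum fun k _ =>
        first_crossing_le μ n hA hmono hB hAB hhalf T hx k
    -- First crossings at different indices are disjoint, so the bound does not grow with the number
    -- of sets in `T`.
    _ = 16 * ∫ S in ⋃ k ∈ T, E k, deviation μ B S ^ 4 ∂P := by
        rw [integral_biUnion_finset T (fun k _ => hE k) hdisj fun k _ => hBint.integrableOn,
          Finset.mul_sum]
    _ ≤ 16 * ∫ S, deviation μ B S ^ 4 ∂P := by
        gcongr
        · exact Eventually.of_forall fun S => by positivity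
        · exact Measure.restrict_le_self
    _ ≤ _ := by
        gcongr
        exact (integral_deviation_pow_le μ n hB).2

end MaximalInequality

/-! ### From tail bounds to the second moment of the supremum -/

section Supremum

variable {α : Type*} [MeasurableSpace α]

/-- Layer cake formula, with the tail bounded by `1` up to level `a` and by `B / s ^ 2` beyond it.
-/
lemma integral_le_of_tail {Ω : Type*} [MeasurableSpace Ω] {P : Measure Ω} [IsProbabilityMeasure P]
    {W : Ω → ℝ} (hW : Integrable W P) (h0 : ∀ ω, 0 ≤ W ω) {B : ℝ}
    (htail : ∀ s, 0 < s → s ^ 2 * P.real {ω | s < W ω} ≤ B) {a : ℝ} (ha : 0 < a) :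
    ∫ ω, W ω ∂P ≤ a + B / a := by
  rw [hW.integral_eq_integral_meas_lt (Eventually.of_forall h0)]
  have hanti : Antitone fun t : ℝ => P.real {ω | t < W ω} := fun s t hst =>
    measureReal_mono fun ω (hω : t < W ω) => lt_of_le_of_lt hst hω
  have hmeas : Measurable fun t : ℝ => P.real {ω | t < W ω} := hanti.measurable
  have hint2 : IntegrableOn (fun t : ℝ => B * t ^ (-2 : ℝ)) (Set.Ioi a) :=
    (integrableOn_Ioi_rpow_of_lt (by norm_num) ha).const_mul B
  have hle : ∀ t ∈ Set.Ioi a, P.real {ω | t < W ω} ≤ B * t ^ (-2 : ℝ) := fun t ht => by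
    have ht0 : 0 < t := ha.trans ht
    rw [Real.rpow_neg ht0.le, ← div_eq_mul_inv, le_div_iff₀ (by positivity), mul_comm]
    simpa using htail t ht0
  have hi2 : IntegrableOn (fun t : ℝ => P.real {ω | t < W ω}) (Set.Ioi a) := by
    refine hint2.mono' hmeas.aestronglyMeasurable ?_
    filter_upwards [self_mem_ae_restrict measurableSet_Ioi] with t ht
    rw [Real.norm_eq_abs, abs_of_nonneg measureReal_nonneg]
    exact hle t ht
  have hi1 : IntegrableOn (fun t : ℝ => P.real {ω | t < W ω}) (Set.Ioc 0 a) :=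
    Measure.integrableOn_of_bounded (M := 1) (by simp) hmeas.aestronglyMeasurable
      (Eventually.of_forall fun t => by
        rw [Real.norm_eq_abs, abs_of_nonneg measureReal_nonneg]; exact measureReal_le_one)
  rw [← Set.Ioc_union_Ioi_eq_Ioi ha.le, setIntegral_union (Set.Ioc_disjoint_Ioi le_rfl)
    measurableSet_Ioi hi1 hi2]
  refine add_le_add ?_ ?_
  · calc _ ≤ ∫ t in Set.Ioc 0 a, (1 : ℝ) :=
          setIntegral_mono_on hi1 (by simp) measurableSet_Ioc fun t _ => measureReal_le_one
      _ = a := by simp [ha.le]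
  · calc _ ≤ ∫ t in Set.Ioi a, B * t ^ (-2 : ℝ) :=
          setIntegral_mono_on hi2 hint2 measurableSet_Ioi hle
      _ = B / a := by
          rw [integral_const_mul, integral_Ioi_rpow_of_lt (by norm_num) ha]
          norm_num [Real.rpow_neg_one]
          rfl

/-- The supremum of the absolute deviations over a family of sets. -/
noncomputable def supDeviation (μ : Measure α) {n : ℕ} {κ : Type*} (A : κ → Set α)
    (S : Fin n → α) : ℝ :=
  ⨆ k, |deviation μ (A k) S|

variable {κ : Type*}

lemma bddAbove_deviation (μ : Measure α) [IsProbabilityMeasure μ] {n : ℕ} (A : κ → Set α)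
    (S : Fin n → α) : BddAbove (Set.range fun k => |deviation μ (A k) S|) :=
  ⟨n, by rintro _ ⟨k, rfl⟩; exact abs_deviation_le μ _ _⟩

lemma abs_deviation_le_sup (μ : Measure α) [IsProbabilityMeasure μ] {n : ℕ} (A : κ → Set α)
    (S : Fin n → α) (k : κ) : |deviation μ (A k) S| ≤ supDeviation μ A S :=
  le_ciSup (bddAbove_deviation μ A S) k

lemma supDeviation_nonneg (μ : Measure α) {n : ℕ} (A : κ → Set α) (S : Fin n → α) :
    0 ≤ supDeviation μ A S :=
  Real.iSup_nonneg fun _ => abs_nonneg _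

lemma supDeviation_le (μ : Measure α) [IsProbabilityMeasure μ] {n : ℕ} (A : κ → Set α)
    (S : Fin n → α) : supDeviation μ A S ≤ n :=
  Real.iSup_le (fun _ => abs_deviation_le μ _ _) (Nat.cast_nonneg _)

lemma measurable_supDeviation [Countable κ] (μ : Measure α) [IsProbabilityMeasure μ] {n : ℕ}
    {A : κ → Set α} (hA : ∀ k, MeasurableSet (A k)) :
    Measurable (supDeviation μ A : (Fin n → α) → ℝ) :=
  Measurable.iSup fun k => (measurable_deviation μ (hA k)).abs

/-- A union bound over the finitely many chains, applied to the fourth moment maximal inequality: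
the square of the supremum has a tail of order `s ^ (-2)`. The level `a` stays free, to be balanced
against the masses of the sets `B j`. -/
lemma integral_supDeviation_sq_le {J ι : Type*} [Fintype J] [LinearOrder ι] [Countable ι]
    [Nonempty J] [Nonempty ι] (μ : Measure α) [IsProbabilityMeasure μ] (n : ℕ)
    {A : J × ι → Set α} (hA : ∀ k, MeasurableSet (A k)) (hmono : ∀ j, Monotone fun k => A (j, k))
    {B : J → Set α} (hB : ∀ j, MeasurableSet (B j)) (hAB : ∀ j k, A (j, k) ⊆ B j)
    (hhalf : ∀ j, μ.real (B j) ≤ 1 / 2) {a : ℝ} (ha : 0 < a) :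
    ∫ S, supDeviation μ A S ^ 2 ∂(Measure.pi fun _ : Fin n => μ)
      ≤ a + 16 * (∑ j, (n * μ.real (B j) + 3 * (n * μ.real (B j)) ^ 2)) / a := by
  set P := Measure.pi fun _ : Fin n => μ
  have hm := measurable_supDeviation (n := n) μ hA
  refine integral_le_of_tail ?_ (fun S => sq_nonneg _) ?_ ha
  · refine integrable_of_bounded (hm.pow_const 2) ((n : ℝ) ^ 2) fun S => ?_
    rw [abs_pow, abs_of_nonneg (supDeviation_nonneg μ A S)]
    exact pow_le_pow_left₀ (supDeviation_nonneg μ A S) (supDeviation_le μ A S) 2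
  intro s hs
  set x := √s
  have hx : 0 < x := Real.sqrt_pos.2 hs
  have hxs : s = x ^ 2 := (Real.sq_sqrt hs.le).symm
  let F : Finset ι → J → Set (Fin n → α) := fun T j => {S | ∃ k ∈ T, x ≤ |deviation μ (A (j, k)) S|}
  have hsub : {S : Fin n → α | s < supDeviation μ A S ^ 2} ⊆ ⋃ T : Finset ι, ⋃ j, F T j := by
    intro S hS
    have h1 : x < supDeviation μ A S := by
      have hS' : x ^ 2 < supDeviation μ A S ^ 2 := by rw [← hxs]; exact hS
      exact lt_of_pow_lt_pow_left₀ 2 (supDeviation_nonneg μ A S) hS'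
    obtain ⟨⟨j, k⟩, hk⟩ := exists_lt_of_lt_ciSup h1
    exact Set.mem_iUnion.2 ⟨{k}, Set.mem_iUnion.2 ⟨j, k, by simp, hk.le⟩⟩
  -- The maximal inequality is about finite subchains, with a bound independent of the subchain, so
  -- it passes to their directed union by continuity from below.
  have hdir : Directed (· ⊆ ·) fun T : Finset ι => ⋃ j, F T j := by
    classical
    intro T T'
    refine ⟨T ∪ T', ?_, ?_⟩
    · exact Set.iUnion_mono fun j S ⟨k, hk, h⟩ => ⟨k, Finset.mem_union_left _ hk, h⟩
    · exact Set.iUnion_mono fun j S ⟨k, hk, h⟩ => ⟨k, Finset.mem_union_right _ hk, h⟩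
  set R := 16 * (∑ j, (n * μ.real (B j) + 3 * (n * μ.real (B j)) ^ 2))
  have hbound : ∀ T, P.real (⋃ j, F T j) ≤ R / x ^ 4 := by
    intro T
    rw [le_div_iff₀ (by positivity), mul_comm]
    calc x ^ 4 * P.real (⋃ j, F T j) ≤ x ^ 4 * ∑ j, P.real (F T j) := by
          gcongr; exact measureReal_iUnion_fintype_le _
      _ = ∑ j, x ^ 4 * P.real (F T j) := Finset.mul_sum _ _ _
      _ ≤ ∑ j, 16 * (n * μ.real (B j) + 3 * (n * μ.real (B j)) ^ 2) :=
          Finset.sum_le_sum fun j _ => measure_exists_deviation_le μ n (fun k => hA (j, k)) (hmono j)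
            (hB j) (hAB j) (hhalf j) T hx.le
      _ = R := (Finset.mul_sum _ _ _).symm
  have hR : 0 ≤ R := by positivity
  have hfin : P.real (⋃ T : Finset ι, ⋃ j, F T j) ≤ R / x ^ 4 := by
    rw [measureReal_def, hdir.measure_iUnion]
    refine ENNReal.toReal_le_of_le_ofReal (by positivity) (iSup_le fun T => ?_)
    rw [← ofReal_measureReal]
    exact ENNReal.ofReal_le_ofReal (hbound T)
  calc s ^ 2 * P.real {S | s < supDeviation μ A S ^ 2} ≤ s ^ 2 * (R / x ^ 4) := by
        gcongr
        exact (measureReal_mono hsub).trans hfin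
    _ = R := by rw [hxs]; field_simp

end Supremum

/-! ### Light cells and reduction to rational endpoints -/

section Cells

/-- The punctured balls decrease to the empty set. The centre has to be removed since it may be an
atom; it will become a cut point. -/
lemma exists_punctured_ball_le {X : Type*} [MetricSpace X] [MeasurableSpace X] [BorelSpace X]
    (μ : Measure X) [IsFiniteMeasure μ] (x : X) {ε : ℝ} (hε : 0 < ε) :
    ∃ r : ℝ, 0 < r ∧ μ.real (Metric.ball x r \ {x}) ≤ ε := by
  have h := tendsto_measure_biInter_gt (μ := μ) (s := fun r : ℝ => Metric.ball x r \ {x}) (a := 0)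
    (fun r _ => (measurableSet_ball.diff (measurableSet_singleton x)).nullMeasurableSet)
    (fun i j _ hij => Set.sdiff_subset_sdiff_left (Metric.ball_subset_ball hij))
    ⟨1, one_pos, measure_ne_top _ _⟩
  have hempty : (⋂ r > (0 : ℝ), Metric.ball x r \ {x}) = ∅ := by
    ext y
    simp only [gt_iff_lt, Set.mem_iInter, Set.mem_sdiff, Metric.mem_ball, Set.mem_singleton_iff,
      Set.mem_empty_iff_false, iff_false, not_forall]
    by_cases hy : y = x
    · exact ⟨1, one_pos, fun h => h.2 hy⟩
    · exact ⟨dist y x, dist_pos.2 hy, fun h => lt_irrefl _ h.1⟩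
  rw [hempty, measure_empty] at h
  have h2 : ∀ᶠ r in 𝓝[>] (0 : ℝ), μ (Metric.ball x r \ {x}) < ENNReal.ofReal ε :=
    h.eventually (gt_mem_nhds (ENNReal.ofReal_pos.2 hε))
  obtain ⟨r, hr, hr0⟩ := (h2.and self_mem_nhdsWithin).exists
  exact ⟨r, hr0, ENNReal.toReal_le_of_le_ofReal hε.le hr.le⟩

/-- The open interval from `j` to the next point of `T`. -/
def cell (T : Finset ℝ≥0) (j : ℝ≥0) : Set ℝ≥0 := {v | j < v ∧ ∀ s ∈ T, j < s → v < s}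

lemma measurableSet_cell (T : Finset ℝ≥0) (j : ℝ≥0) : MeasurableSet (cell T j) := by
  have : cell T j = Set.Ioi j ∩ ⋂ s ∈ T, ⋂ _ : j < s, Set.Iio s := by
    ext v; simp [cell]
  rw [this]
  exact measurableSet_Ioi.inter
    (Finset.measurableSet_biInter _ fun s _ => MeasurableSet.iInter fun _ => measurableSet_Iio)

lemma disjoint_cell {T : Finset ℝ≥0} {i j : ℝ≥0} (hi : i ∈ T) (hj : j ∈ T) (hij : i ≠ j) :
    Disjoint (cell T i) (cell T j) := by
  refine Set.disjoint_left.2 fun v h1 h2 => ?_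
  rcases lt_or_gt_of_ne hij with h | h
  · exact absurd (h1.2 j hj h) (not_lt.2 h2.1.le)
  · exact absurd (h2.2 i hi h) (not_lt.2 h1.1.le)

lemma sum_measure_cell_le (μ : Measure ℝ≥0) [IsProbabilityMeasure μ] (T : Finset ℝ≥0) :
    ∑ j : T, μ.real (cell T j) ≤ 1 := by
  rw [← measureReal_iUnion_fintype]
  · exact measureReal_le_one
  · intro i j hij
    exact disjoint_cell i.2 j.2 fun h => hij (Subtype.ext h)
  · exact fun j => measurableSet_cell T j

/-- Every bounded distribution admits a finite set of cut points whose open gaps are light and short. -/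
lemma exists_light_cells (μ : Measure ℝ≥0) [IsProbabilityMeasure μ] {H : ℝ≥0}
    (hH : ∀ᵐ v ∂μ, v ≤ H) {ε : ℝ} (hε : 0 < ε) :
    ∃ T : Finset ℝ≥0, (∀ j ∈ T, μ.real (cell T j) ≤ ε) ∧
      (∀ p, 0 < p → p ≤ H → ∃ j ∈ T, j < p ∧ ∀ s ∈ T, j < s → p ≤ s) ∧
      ∀ j ∈ T, ∀ p q : ℝ≥0, j < p → j < q → p ≤ H → q ≤ H → (∀ s ∈ T, j < s → p ≤ s) →
        (∀ s ∈ T, j < s → q ≤ s) → |(p : ℝ) - q| ≤ ε := by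
  classical
  choose r hr0 hr using fun x : ℝ≥0 => exists_punctured_ball_le μ x hε
  -- The radius `r x` controls the mass and `ε / 2` the length.
  let R : ℝ≥0 → ℝ≥0 := fun x => (min (r x) (ε / 2)).toNNReal
  have hR0 : ∀ x, 0 < R x := fun x => Real.toNNReal_pos.2 (lt_min (hr0 x) (by linarith))
  have hRe : ∀ x, (R x : ℝ) ≤ ε / 2 := fun x => by
    rw [Real.coe_toNNReal _ (le_min (hr0 x).le (by linarith))]; exact min_le_right _ _
  have hRr : ∀ x, (R x : ℝ) ≤ r x := fun x => by
    rw [Real.coe_toNNReal _ (le_min (hr0 x).le (by linarith))]; exact min_le_left _ _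
  obtain ⟨F, -, hF⟩ := (isCompact_Icc (a := (0 : ℝ≥0)) (b := H)).elim_nhds_subcover
    (fun x => Metric.ball x (R x)) fun x _ => Metric.ball_mem_nhds x (by exact_mod_cast hR0 x)
  -- Cutting at `x ± R x` keeps a cell below `H` that meets a covering ball inside that ball, and
  -- cutting at `x` keeps a possible atom out of it. The point `0` lies below every positive price,
  -- and `H` leaves only null cells above it.
  let T : Finset ℝ≥0 := {0, H} ∪ F.biUnion fun x => {x, x - R x, x + R x}
  have h0T : (0 : ℝ≥0) ∈ T := by simp [T]
  have hHT : H ∈ T := by simp [T]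
  have hT1 : ∀ x ∈ F, x ∈ T := fun x hx =>
    Finset.mem_union_right _ (Finset.mem_biUnion.2 ⟨x, hx, by simp⟩)
  have hT2 : ∀ x ∈ F, x - R x ∈ T := fun x hx =>
    Finset.mem_union_right _ (Finset.mem_biUnion.2 ⟨x, hx, by simp⟩)
  have hT3 : ∀ x ∈ F, x + R x ∈ T := fun x hx =>
    Finset.mem_union_right _ (Finset.mem_biUnion.2 ⟨x, hx, by simp⟩)
  have hball : ∀ z ≤ H, ∃ x ∈ F, z < x + R x ∧ x < z + R x := by
    intro z hz
    obtain ⟨x, hx, hzx⟩ := Set.mem_iUnion₂.1 (hF ⟨zero_le, hz⟩)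
    rw [Metric.mem_ball, NNReal.dist_eq, abs_lt] at hzx
    refine ⟨x, hx, ?_, ?_⟩
    · rw [← NNReal.coe_lt_coe]; push_cast; linarith
    · rw [← NNReal.coe_lt_coe]; push_cast; linarith
  refine ⟨T, fun j hj => ?_, fun p hp _ => ?_, fun j hj p q hjp hjq hp hq hps hqs => ?_⟩
  · rcases le_or_gt H j with hHj | hHj
    · have : μ.real (cell T j) = 0 := by
        rw [measureReal_def, measure_mono_null (t := {v | ¬ v ≤ H}) _ hH]
        · rfl
        · exact fun v hv => not_le.2 (lt_of_le_of_lt hHj hv.1)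
      rw [this]; exact hε.le
    rcases (cell T j).eq_empty_or_nonempty with he | ⟨z, hz⟩
    · rw [he]; simpa using hε.le
    obtain ⟨x, hx, hz1, hz2⟩ := hball z (hz.2 H hHT hHj).le
    refine (measureReal_mono ?_).trans (hr x)
    intro w hw
    have hw1 : w < x + R x := hw.2 _ (hT3 x hx) (hz.1.trans hz1)
    have hw2 : x < w + R x := by
      by_contra hcon
      have hle : w ≤ x - R x := le_tsub_of_add_le_right (not_lt.1 hcon)
      have h3 := hz.2 _ (hT2 x hx) (lt_of_lt_of_le hw.1 hle)
      exact absurd (lt_tsub_iff_right.1 h3) (not_lt.2 hz2.le)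
    refine ⟨?_, fun hwx => ?_⟩
    · rw [Metric.mem_ball, NNReal.dist_eq]
      refine lt_of_lt_of_le (abs_lt.2 ⟨?_, ?_⟩) (hRr x)
      · rw [← NNReal.coe_lt_coe] at hw2; push_cast at hw2; linarith
      · rw [← NNReal.coe_lt_coe] at hw1; push_cast at hw1; linarith
    · rw [Set.mem_singleton_iff] at hwx
      subst hwx
      exact lt_irrefl _ (hw.2 w (hT1 w hx) hw.1)
  · let T' := T.filter (· < p)
    have hne : T'.Nonempty := ⟨0, by simp [T', h0T, hp]⟩
    have hmax := T'.max'_mem hne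
    simp only [T', Finset.mem_filter] at hmax
    refine ⟨T'.max' hne, hmax.1, hmax.2, fun s hs hlt => ?_⟩
    by_contra hcon
    exact absurd (T'.le_max' s (by simp [T', hs, not_le.1 hcon])) (not_le.2 hlt)
  · wlog hpq : p ≤ q generalizing p q
    · rw [abs_sub_comm]
      exact this q p hjq hjp hq hp hqs hps (le_of_not_ge hpq)
    -- The ball around `x` contains `p`, so `x + R x` is a cut point above `j` and `q` cannot pass
    -- it. Hence `q - p ≤ 2 R x ≤ ε`.
    obtain ⟨x, hx, hp1, hp2⟩ := hball p hp
    have h1 : q ≤ x + R x := hqs _ (hT3 x hx) (hjp.trans hp1)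
    have h2 := hRe x
    rw [← NNReal.coe_le_coe] at h1 hpq
    rw [← NNReal.coe_lt_coe] at hp2
    push_cast at h1 hp2
    rw [abs_sub_comm, abs_of_nonneg (by linarith)]
    linarith

lemma deviation_union (μ : Measure ℝ≥0) [IsProbabilityMeasure μ] {n : ℕ} {A B : Set ℝ≥0}
    (hB : MeasurableSet B) (hAB : Disjoint A B) (S : Fin n → ℝ≥0) :
    deviation μ (A ∪ B) S = deviation μ A S + deviation μ B S := by
  simp only [deviation, ← Finset.sum_add_distrib]
  refine Finset.sum_congr rfl fun i _ => ?_
  rw [measureReal_union hAB hB, Set.indicator_union_of_disjoint hAB]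
  ring

/-- The deviation of `C ∩ [0, p)` is controlled by those with rational endpoints. -/
lemma abs_deviation_inter_Iio_le (μ : Measure ℝ≥0) [IsProbabilityMeasure μ] {n : ℕ} {C : Set ℝ≥0}
    (hC : MeasurableSet C) (S : Fin n → ℝ≥0) (p : ℝ≥0) {M : ℝ}
    (hM : ∀ q : ℚ≥0, |deviation μ (C ∩ Set.Iio (q : ℝ≥0)) S| ≤ M) :
    |deviation μ (C ∩ Set.Iio p) S| ≤ M := by
  rcases eq_or_ne p 0 with rfl | hp
  · simpa using hM 0
  refine le_of_forall_pos_le_add fun δ hδ => ?_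
  have hδ' : 0 < δ / (n + 1) := by positivity
  obtain ⟨r, hr0, hr⟩ := exists_punctured_ball_le μ p hδ'
  -- A rational `q < p` close enough to `p` has no sample in `[q, p)`, and this interval has mass at
  -- most `δ / (n + 1)`. The count is then unchanged, and `n` times the mass moves by at most `δ`.
  have hev : ∀ᶠ q in 𝓝[<] p, (∀ i, S i < p → S i < q) ∧ q ∈ Metric.ball p r := by
    refine Filter.Eventually.and (eventually_all.2 fun i => ?_)
      (mem_nhdsWithin_of_mem_nhds (Metric.ball_mem_nhds p hr0))
    by_cases hi : S i < p
    · filter_upwards [mem_nhdsWithin_of_mem_nhds (lt_mem_nhds hi)] with q hq _ using hq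
    · exact Eventually.of_forall fun q h => absurd h hi
  rw [eventually_iff, mem_nhdsLT_iff_exists_Ioo_subset' (a := p) (l' := 0) (pos_of_ne_zero hp)] at hev
  obtain ⟨l, hl, hsub⟩ := hev
  obtain ⟨q, hq1, hq2⟩ : ∃ q : ℚ≥0, l < (q : ℝ≥0) ∧ (q : ℝ≥0) < p := by
    obtain ⟨x, h1, h2⟩ := exists_rat_btwn (NNReal.coe_lt_coe.2 hl)
    have hx : 0 ≤ x := by
      have : (0 : ℝ) ≤ x := (NNReal.coe_nonneg l).trans h1.le
      exact_mod_cast this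
    lift x to ℚ≥0 using hx
    have e : ((x : ℝ≥0) : ℝ) = (x : ℝ) := rfl
    refine ⟨x, ?_, ?_⟩
    · rw [← NNReal.coe_lt_coe, e]; exact_mod_cast h1
    · rw [← NNReal.coe_lt_coe, e]; exact_mod_cast h2
  obtain ⟨hS, hqb⟩ := hsub ⟨hq1, hq2⟩
  have hmem : ∀ i, S i ∈ C ∩ Set.Iio p ↔ S i ∈ C ∩ Set.Iio (q : ℝ≥0) := fun i =>
    and_congr_right fun _ => ⟨fun h => hS i h, fun h => lt_trans h hq2⟩
  have hmass : |μ.real (C ∩ Set.Iio (q : ℝ≥0)) - μ.real (C ∩ Set.Iio p)| ≤ δ / (n + 1) := by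
    have hd : C ∩ Set.Iio p = (C ∩ Set.Iio (q : ℝ≥0)) ∪ (C ∩ Set.Ico (q : ℝ≥0) p) := by
      rw [← Set.inter_union_distrib_left, Set.Iio_union_Ico_eq_Iio hq2.le]
    have hdis : Disjoint (C ∩ Set.Iio (q : ℝ≥0)) (C ∩ Set.Ico (q : ℝ≥0) p) := by
      refine Set.disjoint_left.2 fun v h1 h2 => absurd h1.2 (not_lt.2 h2.2.1)
    rw [hd, measureReal_union hdis (hC.inter measurableSet_Ico), sub_add_cancel_left, abs_neg,
      abs_of_nonneg measureReal_nonneg]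
    refine (measureReal_mono ?_).trans hr
    rintro v ⟨-, hv1, hv2⟩
    refine ⟨?_, hv2.ne⟩
    rw [Metric.mem_ball, NNReal.dist_eq, abs_lt] at hqb ⊢
    rw [← NNReal.coe_le_coe] at hv1
    rw [← NNReal.coe_lt_coe] at hv2
    constructor <;> linarith [hqb.1]
  have hdev : deviation μ (C ∩ Set.Iio p) S = deviation μ (C ∩ Set.Iio (q : ℝ≥0)) S
      + n * (μ.real (C ∩ Set.Iio (q : ℝ≥0)) - μ.real (C ∩ Set.Iio p)) := by
    have hi : ∀ i, (C ∩ Set.Iio p).indicator (fun _ => (1 : ℝ)) (S i)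
        = (C ∩ Set.Iio (q : ℝ≥0)).indicator (fun _ => (1 : ℝ)) (S i) := fun i => by
      by_cases h : S i ∈ C ∩ Set.Iio p
      · rw [Set.indicator_of_mem h, Set.indicator_of_mem ((hmem i).1 h)]
      · rw [Set.indicator_of_notMem h, Set.indicator_of_notMem fun h' => h ((hmem i).2 h')]
    simp only [deviation, hi, Finset.sum_sub_distrib, Finset.sum_const, Finset.card_univ,
      Fintype.card_fin, nsmul_eq_mul]
    ring
  rw [hdev]
  refine (abs_add_le _ _).trans (add_le_add (hM q) ?_)
  rw [abs_mul, Nat.abs_cast]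
  calc (n : ℝ) * _ ≤ n * (δ / (n + 1)) := by gcongr
    _ ≤ δ := by
      rw [mul_div_assoc', div_le_iff₀ (by positivity)]; nlinarith

end Cells

/-! ### Elementary properties of revenue and regret -/

section Revenue

instance (t : PricingAlgorithm) (n : ℕ) : IsMarkovKernel (t.kernel n) := t.isMarkov n

lemma rev_nonneg (D : ValuationDist) (p : ℝ≥0) : 0 ≤ rev D p :=
  mul_nonneg p.2 measureReal_nonneg

lemma rev_zero (D : ValuationDist) : rev D 0 = 0 := by simp [rev]

lemma measurable_rev (D : ValuationDist) : Measurable (rev D) := by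
  have h : Antitone fun p : ℝ≥0 => (D : Measure ℝ≥0).real (Set.Ici p) := fun p q hpq =>
    measureReal_mono (Set.Ici_subset_Ici.2 hpq)
  exact measurable_coe_nnreal_real.mul h.measurable

variable {D : ValuationDist} {H : ℝ≥0}

lemma measure_Ici_eq_zero (hH : ∀ᵐ v ∂(D : Measure ℝ≥0), v ≤ H) {p : ℝ≥0} (hp : H < p) :
    (D : Measure ℝ≥0).real (Set.Ici p) = 0 := by
  rw [measureReal_def, measure_mono_null (t := {v | ¬ v ≤ H}) _ hH]
  · rfl
  · exact fun v hv => not_le.2 (lt_of_lt_of_le hp hv)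

lemma rev_eq_zero (hH : ∀ᵐ v ∂(D : Measure ℝ≥0), v ≤ H) {p : ℝ≥0} (hp : H < p) : rev D p = 0 := by
  rw [rev, measure_Ici_eq_zero hH hp, mul_zero]

lemma rev_le (hH : ∀ᵐ v ∂(D : Measure ℝ≥0), v ≤ H) (p : ℝ≥0) : rev D p ≤ H := by
  rcases le_or_gt p H with h | h
  · calc rev D p ≤ p * 1 := mul_le_mul_of_nonneg_left measureReal_le_one p.2
      _ ≤ H := by simpa using h
  · rw [rev_eq_zero hH h]; exact H.2

lemma abs_rev_le (hH : ∀ᵐ v ∂(D : Measure ℝ≥0), v ≤ H) (p : ℝ≥0) : |rev D p| ≤ H := by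
  rw [abs_of_nonneg (rev_nonneg D p)]; exact rev_le hH p

lemma rev_le_opt (hH : ∀ᵐ v ∂(D : Measure ℝ≥0), v ≤ H) (p : ℝ≥0) : rev D p ≤ opt D :=
  le_ciSup (f := rev D) ⟨H, by rintro _ ⟨q, rfl⟩; exact rev_le hH q⟩ p

lemma opt_le_of_forall {r : ℝ} (h : ∀ p, rev D p ≤ r) : opt D ≤ r := ciSup_le h

lemma integrable_rev (hH : ∀ᵐ v ∂(D : Measure ℝ≥0), v ≤ H) (ν : Measure ℝ≥0) [IsFiniteMeasure ν] :
    Integrable (rev D) ν :=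
  integrable_of_bounded (measurable_rev D) H (abs_rev_le hH)

lemma measurable_integral_rev (t : PricingAlgorithm) (n : ℕ) :
    Measurable fun S => ∫ p, rev D p ∂(t.kernel n S) :=
  ((measurable_rev D).stronglyMeasurable.integral_kernel (κ := t.kernel n)).measurable

lemma integral_rev_nonneg (t : PricingAlgorithm) (n : ℕ) (S : Fin n → ℝ≥0) :
    0 ≤ ∫ p, rev D p ∂(t.kernel n S) :=
  integral_nonneg fun p => rev_nonneg D p

lemma integral_rev_le (hH : ∀ᵐ v ∂(D : Measure ℝ≥0), v ≤ H) (t : PricingAlgorithm) (n : ℕ)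
    (S : Fin n → ℝ≥0) : ∫ p, rev D p ∂(t.kernel n S) ≤ H :=
  calc _ ≤ ∫ _, (H : ℝ) ∂(t.kernel n S) :=
        integral_mono (integrable_rev hH _) (integrable_const _) (rev_le hH)
    _ = H := by simp

lemma integrable_integral_rev (hH : ∀ᵐ v ∂(D : Measure ℝ≥0), v ≤ H) (t : PricingAlgorithm) (n : ℕ)
    (P : Measure (Fin n → ℝ≥0)) [IsFiniteMeasure P] :
    Integrable (fun S => ∫ p, rev D p ∂(t.kernel n S)) P :=
  integrable_of_bounded (measurable_integral_rev t n) H fun S => by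
    rw [abs_of_nonneg (integral_rev_nonneg t n S)]; exact integral_rev_le hH t n S

lemma ae_sample_le (hH : ∀ᵐ v ∂(D : Measure ℝ≥0), v ≤ H) (n : ℕ) :
    ∀ᵐ S ∂(Measure.pi fun _ : Fin n => (D : Measure ℝ≥0)), ∀ i, S i ≤ H := by
  rw [eventually_all]
  intro i
  exact (Measure.tendsto_eval_ae_ae (μ := fun _ : Fin n => (D : Measure ℝ≥0)) (i := i)).eventually hH

lemma revGap_le_integral (hH : ∀ᵐ v ∂(D : Measure ℝ≥0), v ≤ H) (t : PricingAlgorithm) (n : ℕ)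
    {Φ : (Fin n → ℝ≥0) → ℝ} (hΦ : Integrable Φ (Measure.pi fun _ : Fin n => (D : Measure ℝ≥0)))
    (h : ∀ S, (∀ i, S i ≤ H) → ∀ᵐ p ∂(t.kernel n S), opt D - rev D p ≤ Φ S) :
    revGap t D n ≤ ∫ S, Φ S ∂(Measure.pi fun _ : Fin n => (D : Measure ℝ≥0)) := by
  set P := Measure.pi fun _ : Fin n => (D : Measure ℝ≥0)
  have h1 : ∫ S, (opt D - Φ S) ∂P ≤ expectedRev t D n := by
    refine integral_mono_ae ((integrable_const _).sub hΦ) (integrable_integral_rev hH t n _) ?_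
    filter_upwards [ae_sample_le hH n] with S hS
    calc opt D - Φ S = ∫ _, (opt D - Φ S) ∂(t.kernel n S) := by simp
      _ ≤ ∫ p, rev D p ∂(t.kernel n S) := by
        refine integral_mono_ae (integrable_const _) (integrable_rev hH _) ?_
        filter_upwards [h S hS] with p hp
        linarith
  rw [integral_sub (integrable_const _) hΦ] at h1
  simp only [integral_const, probReal_univ, one_smul] at h1
  unfold revGap
  linarith

end Revenue

/-! ### Deviations of half-lines, globally and within cells -/

section GlobalDeviation

lemma deviation_Ici (μ : Measure ℝ≥0) [IsProbabilityMeasure μ] {n : ℕ} (p : ℝ≥0)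
    (S : Fin n → ℝ≥0) : deviation μ (Set.Ici p) S = -deviation μ (Set.Iio p) S := by
  have h := deviation_union μ (A := Set.Iio p) (B := Set.Ici p) measurableSet_Ici
    (Set.disjoint_left.2 fun v h1 h2 => not_lt.2 (Set.mem_Ici.1 h2) h1) S
  have hu : Set.Iio p ∪ Set.Ici p = Set.univ := Set.Iio_union_Ici
  rw [hu] at h
  have h0 : deviation μ Set.univ S = 0 := by simp [deviation]
  linarith

lemma deviation_Iio_eq (μ : Measure ℝ≥0) [IsProbabilityMeasure μ] {n : ℕ} {T : Finset ℝ≥0}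
    {j p : ℝ≥0} (hjp : j < p) (hp : ∀ s ∈ T, j < s → p ≤ s) (S : Fin n → ℝ≥0) :
    deviation μ (Set.Iio p) S = deviation μ (Set.Iic j) S + deviation μ (cell T j ∩ Set.Iio p) S := by
  rw [← deviation_union μ ((measurableSet_cell T j).inter measurableSet_Iio)]
  · congr 1
    ext v
    simp only [Set.mem_Iio, Set.mem_union, Set.mem_Iic, Set.mem_inter_iff, cell, Set.mem_ofPred_eq]
    constructor
    · intro hv
      rcases le_or_gt v j with h | h
      · exact Or.inl h
      · exact Or.inr ⟨⟨h, fun s hs hjs => lt_of_lt_of_le hv (hp s hs hjs)⟩, hv⟩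
    · rintro (h | h)
      · exact lt_of_le_of_lt h hjp
      · exact h.2
  · exact Set.disjoint_left.2 fun v h1 h2 => absurd h2.1.1 (not_lt.2 h1)

/-- The largest deviation over the initial segments with rational endpoints of the cells of `T`. -/
noncomputable def cellDeviation (μ : Measure ℝ≥0) (T : Finset ℝ≥0) {n : ℕ} (S : Fin n → ℝ≥0) : ℝ :=
  supDeviation μ (fun k : T × ℚ≥0 => cell T k.1 ∩ Set.Iio (k.2 : ℝ≥0)) S

lemma measurable_cellDeviation (μ : Measure ℝ≥0) [IsProbabilityMeasure μ] (T : Finset ℝ≥0) (n : ℕ) :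
    Measurable (cellDeviation μ T : (Fin n → ℝ≥0) → ℝ) :=
  measurable_supDeviation μ fun k => (measurableSet_cell T k.1).inter measurableSet_Iio

lemma abs_cellDeviation_le (μ : Measure ℝ≥0) [IsProbabilityMeasure μ] (T : Finset ℝ≥0) {n : ℕ}
    (S : Fin n → ℝ≥0) : |cellDeviation μ T S| ≤ n :=
  (abs_of_nonneg (supDeviation_nonneg μ _ S)).trans_le (supDeviation_le μ _ S)

lemma abs_deviation_le_cellDeviation (μ : Measure ℝ≥0) [IsProbabilityMeasure μ] {T : Finset ℝ≥0}
    {n : ℕ} (S : Fin n → ℝ≥0) {j : ℝ≥0} (hj : j ∈ T) (p : ℝ≥0) :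
    |deviation μ (cell T j ∩ Set.Iio p) S| ≤ cellDeviation μ T S :=
  abs_deviation_inter_Iio_le μ (measurableSet_cell T j) S p fun q =>
    abs_deviation_le_sup μ (fun k : T × ℚ≥0 => cell T k.1 ∩ Set.Iio (k.2 : ℝ≥0)) S (⟨j, hj⟩, q)

/-- The masses of the cells sum to at most one and are each at most `ε`, so their squares sum to at
most `ε`. This is the gain from fourth moments: in a second moment bound the masses enter linearly,
and refining the cells would not help. -/
lemma integral_cellDeviation_sq_le (μ : Measure ℝ≥0) [IsProbabilityMeasure μ] {T : Finset ℝ≥0}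
    (hne : T.Nonempty) {ε : ℝ} (hε : ε ≤ 1 / 2) (hT : ∀ j ∈ T, μ.real (cell T j) ≤ ε) (n : ℕ)
    {a : ℝ} (ha : 0 < a) :
    ∫ S, cellDeviation μ T S ^ 2 ∂(Measure.pi fun _ : Fin n => μ)
      ≤ a + 16 * (n + 3 * ε * n ^ 2) / a := by
  have : Nonempty T := hne.to_subtype
  have h := integral_supDeviation_sq_le (J := T) (ι := ℚ≥0) μ n
    (A := fun k : T × ℚ≥0 => cell T k.1 ∩ Set.Iio (k.2 : ℝ≥0))
    (fun k => (measurableSet_cell T k.1).inter measurableSet_Iio)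
    (fun j p q hpq => Set.inter_subset_inter_right _ (Set.Iio_subset_Iio (by exact_mod_cast hpq)))
    (B := fun j : T => cell T j) (fun j => measurableSet_cell T j)
    (fun j k => Set.inter_subset_left) (fun j => (hT j j.2).trans hε) ha
  refine h.trans ?_
  have hsum := sum_measure_cell_le μ T
  have : ∑ j : T, ((n : ℝ) * μ.real (cell T j) + 3 * (n * μ.real (cell T j)) ^ 2)
      ≤ n + 3 * ε * n ^ 2 := by
    calc _ ≤ ∑ j : T, ((n : ℝ) + 3 * ε * n ^ 2) * μ.real (cell T j) := by
          refine Finset.sum_le_sum fun j _ => ?_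
          have h1 := hT j j.2
          have h2 : 0 ≤ μ.real (cell T j) := measureReal_nonneg
          have h3 : μ.real (cell T j) * μ.real (cell T j) ≤ ε * μ.real (cell T j) := by gcongr
          have h4 : (n : ℝ) ^ 2 * (μ.real (cell T j) * μ.real (cell T j))
            ≤ n ^ 2 * (ε * μ.real (cell T j)) := by gcongr
          nlinarith
      _ = ((n : ℝ) + 3 * ε * n ^ 2) * ∑ j : T, μ.real (cell T j) := (Finset.mul_sum _ _ _).symm
      _ ≤ ((n : ℝ) + 3 * ε * n ^ 2) * 1 := by
          have : 0 ≤ ε := measureReal_nonneg.trans (hT _ hne.choose_spec)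
          gcongr
      _ = _ := mul_one _
  gcongr

/-- A measurable bound, with second moment of order `n`, for the deviation of all half-lines. -/
lemma exists_global_deviation (μ : Measure ℝ≥0) [IsProbabilityMeasure μ] {H : ℝ≥0}
    (hH : ∀ᵐ v ∂μ, v ≤ H) :
    ∃ C : ℝ, 0 ≤ C ∧ ∀ n : ℕ, ∃ Y : (Fin n → ℝ≥0) → ℝ, Measurable Y ∧ (∃ K, ∀ S, |Y S| ≤ K) ∧
      (∀ S, ∀ p ≤ H, |deviation μ (Set.Ici p) S| ≤ Y S) ∧
      ∫ S, Y S ^ 2 ∂(Measure.pi fun _ : Fin n => μ) ≤ C * n := by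
  obtain ⟨T, hT1, hT2, -⟩ := exists_light_cells μ hH (ε := 1 / 2) (by norm_num)
  rcases T.eq_empty_or_nonempty with hTe | hne
  · refine ⟨0, le_rfl, fun n => ⟨fun _ => 0, measurable_const, ⟨0, by simp⟩, fun S p hp => ?_, by simp⟩⟩
    rcases eq_or_ne p 0 with rfl | h0
    · rw [deviation_Ici]; simp [deviation]
    · obtain ⟨j, hj, -⟩ := hT2 p (pos_of_ne_zero h0) hp
      simp [hTe] at hj
  -- The factors `2` come from `(u + v)² ≤ 2 u² + 2 v²`. The level `a = n` bounds the cell term by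
  -- `n + 16 + 24 n ≤ 41 n`, and Cauchy–Schwarz over the cut points gives `T.card ^ 2 * n`.
  refine ⟨2 * 41 + 2 * T.card ^ 2, by positivity, fun n => ?_⟩
  set P := Measure.pi fun _ : Fin n => μ
  have hVm := measurable_cellDeviation μ T n
  have hdm : ∀ j : ℝ≥0, Measurable (deviation μ (Set.Iic j) : (Fin n → ℝ≥0) → ℝ) := fun j =>
    measurable_deviation μ measurableSet_Iic
  have hVn : ∀ S : Fin n → ℝ≥0, |cellDeviation μ T S| ≤ n := abs_cellDeviation_le μ T
  let Y : (Fin n → ℝ≥0) → ℝ := fun S => cellDeviation μ T S + ∑ j ∈ T, |deviation μ (Set.Iic j) S|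
  have hYm : Measurable Y := hVm.add (Finset.measurable_sum _ fun j _ => (hdm j).abs)
  have hi1 : Integrable (fun S => 2 * cellDeviation μ T S ^ 2) P :=
    (integrable_of_bounded (hVm.pow_const 2) ((n : ℝ) ^ 2) fun S => by
      rw [abs_pow]; exact pow_le_pow_left₀ (abs_nonneg _) (hVn S) 2).const_mul 2
  have hi3 : ∀ j ∈ T, Integrable (fun S => deviation μ (Set.Iic j) S ^ 2) P := fun j _ =>
    integrable_of_bounded ((hdm j).pow_const 2) ((n : ℝ) ^ 2) fun S => by
      rw [abs_pow]; exact pow_le_pow_left₀ (abs_nonneg _) (abs_deviation_le _ _ _) 2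
  have hi2 : Integrable (fun S => 2 * (T.card * ∑ j ∈ T, deviation μ (Set.Iic j) S ^ 2)) P :=
    ((integrable_finsetSum _ hi3).const_mul _).const_mul 2
  have hYb : ∀ S, |Y S| ≤ n + ∑ j ∈ T, (n : ℝ) := fun S => by
    refine (abs_add_le _ _).trans (add_le_add (hVn S) ((Finset.abs_sum_le_sum_abs _ _).trans ?_))
    refine Finset.sum_le_sum fun j _ => ?_
    rw [abs_abs]; exact abs_deviation_le _ _ _
  refine ⟨Y, hYm, ⟨_, hYb⟩, fun S p hp => ?_, ?_⟩
  · rw [deviation_Ici, abs_neg]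
    have hsn : 0 ≤ ∑ j ∈ T, |deviation μ (Set.Iic j) S| := Finset.sum_nonneg fun _ _ => abs_nonneg _
    rcases eq_or_ne p 0 with rfl | h0
    · have : deviation μ (Set.Iio (0 : ℝ≥0)) S = 0 := by simp [deviation]
      rw [this, abs_zero]
      exact add_nonneg (supDeviation_nonneg _ _ _) hsn
    · obtain ⟨j, hj, hjp, hps⟩ := hT2 p (pos_of_ne_zero h0) hp
      rw [deviation_Iio_eq μ hjp hps S, add_comm]
      refine (abs_add_le _ _).trans (add_le_add (abs_deviation_le_cellDeviation μ S hj p) ?_)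
      exact Finset.single_le_sum (f := fun j => |deviation μ (Set.Iic j) S|)
        (fun _ _ => abs_nonneg _) hj
  · rcases Nat.eq_zero_or_pos n with rfl | hn
    · have : ∀ S, Y S = 0 := fun S => by
        have := hYb S; simpa using this
      simp [this]
    have hn' : (0 : ℝ) < n := by exact_mod_cast hn
    have hpt : ∀ S, Y S ^ 2 ≤ 2 * cellDeviation μ T S ^ 2
        + 2 * (T.card * ∑ j ∈ T, deviation μ (Set.Iic j) S ^ 2) := fun S => by
      have h1 := sq_sum_le_card_mul_sum_sq (s := T) (f := fun j => |deviation μ (Set.Iic j) S|)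
      simp only [sq_abs] at h1
      have h2 : Y S ^ 2 ≤ 2 * cellDeviation μ T S ^ 2
          + 2 * (∑ j ∈ T, |deviation μ (Set.Iic j) S|) ^ 2 := by
        simp only [Y]
        nlinarith [sq_nonneg (cellDeviation μ T S - ∑ j ∈ T, |deviation μ (Set.Iic j) S|)]
      linarith
    have hYi : Integrable (fun S => Y S ^ 2) P :=
      integrable_of_bounded (hYm.pow_const 2) _ fun S => by
        rw [abs_pow]; exact pow_le_pow_left₀ (abs_nonneg _) (hYb S) 2
    have hV := integral_cellDeviation_sq_le μ hne le_rfl hT1 n (a := n) hn'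
    have hV2 : (n : ℝ) + 16 * (n + 3 * (1 / 2) * n ^ 2) / n = n + 16 + 24 * n := by
      field_simp; ring
    have hn1 : (1 : ℝ) ≤ n := by exact_mod_cast hn
    calc ∫ S, Y S ^ 2 ∂P ≤ ∫ S, (2 * cellDeviation μ T S ^ 2
        + 2 * (T.card * ∑ j ∈ T, deviation μ (Set.Iic j) S ^ 2)) ∂P :=
          integral_mono hYi (hi1.add hi2) hpt
      _ = 2 * ∫ S, cellDeviation μ T S ^ 2 ∂P
          + 2 * (T.card * ∑ j ∈ T, ∫ S, deviation μ (Set.Iic j) S ^ 2 ∂P) := by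
          rw [integral_add hi1 hi2, integral_const_mul, integral_const_mul, integral_const_mul,
            integral_finsetSum _ hi3]
      _ ≤ 2 * (41 * n) + 2 * (T.card * ∑ j ∈ T, (n : ℝ)) := by
          gcongr with j hj
          · rw [hV2] at hV; linarith
          · exact integral_deviation_sq_le μ n measurableSet_Iic
      _ = _ := by simp; ring

end GlobalDeviation

/-! ### The regret of empirical revenue maximization -/

section EmpiricalRevenueMaximization

lemma empiricalRev_sub_rev (D : ValuationDist) {n : ℕ} (hn : 0 < n) (S : Fin n → ℝ≥0) (p : ℝ≥0) :
    empiricalRev S p - rev D p = p / n * deviation (D : Measure ℝ≥0) (Set.Ici p) S := by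
  have hn' : (n : ℝ) ≠ 0 := by exact_mod_cast hn.ne'
  have : deviation (D : Measure ℝ≥0) (Set.Ici p) S
      = ((Finset.univ.filter fun i => p ≤ S i).card : ℝ) - n * (D : Measure ℝ≥0).real (Set.Ici p) := by
    simp only [deviation, Finset.sum_sub_distrib, Finset.sum_const, Finset.card_univ,
      Fintype.card_fin, nsmul_eq_mul]
    congr 1
    simp [Set.indicator_apply]
  rw [this, empiricalRev, rev]
  field_simp

variable {D : ValuationDist} {H : ℝ≥0}

/-- The revenue loss of an empirical maximizer is controlled by the oscillation of the empirical process
inside the cells of `T`, up to second order terms. -/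
lemma exists_erm_gap_le (hH : ∀ᵐ v ∂(D : Measure ℝ≥0), v ≤ H) {ε : ℝ} (hε : 0 < ε)
    {T : Finset ℝ≥0}
    (hT2 : ∀ p, 0 < p → p ≤ H → ∃ j ∈ T, j < p ∧ ∀ s ∈ T, j < s → p ≤ s)
    (hT3 : ∀ j ∈ T, ∀ p q : ℝ≥0, j < p → j < q → p ≤ H → q ≤ H → (∀ s ∈ T, j < s → p ≤ s) →
        (∀ s ∈ T, j < s → q ≤ s) → |(p : ℝ) - q| ≤ ε) :
    ∃ η : ℝ, 0 < η ∧ ∀ (n : ℕ), 0 < n → ∀ S : Fin n → ℝ≥0, (∀ i, S i ≤ H) → ∀ Y : ℝ,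
      (∀ p ≤ H, |deviation (D : Measure ℝ≥0) (Set.Ici p) S| ≤ Y) →
      ∀ p, (∀ q, empiricalRev S q ≤ empiricalRev S p) →
      opt D - rev D p ≤ (ε * Y + 2 * H * cellDeviation (D : Measure ℝ≥0) T S) / n
        + 4 * (H : ℝ) ^ 2 / η * (Y / n) ^ 2 := by
  have hopt0 : 0 ≤ opt D := (rev_nonneg D 0).trans (rev_le_opt hH 0)
  have hnear : ∀ θ > 0, ∃ q ≤ H, opt D - θ < rev D q := by
    intro θ hθ
    obtain ⟨q, hq⟩ := exists_lt_of_lt_ciSup (f := rev D) (show opt D - θ < ⨆ p, rev D p by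
      change opt D - θ < opt D; linarith)
    rcases le_or_gt q H with h | h
    · exact ⟨q, h, hq⟩
    · refine ⟨0, zero_le, ?_⟩
      rw [rev_eq_zero hH h] at hq
      rwa [rev_zero]
  let Q : ℝ≥0 → ℝ≥0 → Prop := fun j q => j < q ∧ q ≤ H ∧ ∀ s ∈ T, j < s → q ≤ s
  -- The dichotomy between cells where the revenue approaches the optimum and cells that miss it by
  -- a fixed `η`. Requiring also `η ≤ opt D` treats prices of zero revenue like those of the second
  -- kind.
  have hη : ∃ η : ℝ, 0 < η ∧ (0 < opt D → η ≤ opt D) ∧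
      ∀ j ∈ T, (∀ θ > 0, ∃ q, Q j q ∧ opt D - θ < rev D q) ∨ ∀ q, Q j q → rev D q ≤ opt D - η := by
    have h1 : ∀ᶠ η in 𝓝[>] (0 : ℝ), ∀ j ∈ T, (∀ θ > 0, ∃ q, Q j q ∧ opt D - θ < rev D q) ∨
        ∀ q, Q j q → rev D q ≤ opt D - η := by
      rw [eventually_all_finset]
      intro j hj
      by_cases h : ∀ θ > 0, ∃ q, Q j q ∧ opt D - θ < rev D q
      · exact Eventually.of_forall fun _ => Or.inl h
      · push Not at h
        obtain ⟨θ, hθ, hq⟩ := h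
        filter_upwards [mem_nhdsWithin_of_mem_nhds (gt_mem_nhds hθ)] with η hη'
        exact Or.inr fun q hQ => (hq q hQ).trans (by linarith)
    have h2 : ∀ᶠ η in 𝓝[>] (0 : ℝ), 0 < opt D → η ≤ opt D := by
      rcases hopt0.eq_or_lt with h | h
      · exact Eventually.of_forall fun _ h' => absurd h' (by rw [← h]; exact lt_irrefl 0)
      · filter_upwards [mem_nhdsWithin_of_mem_nhds (gt_mem_nhds h)] with η hη' _ using hη'.le
    obtain ⟨η, ⟨h3, h4⟩, h5⟩ := ((h1.and h2).and self_mem_nhdsWithin).exists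
    exact ⟨η, h5, h4, h3⟩
  obtain ⟨η, hη0, hηopt, hηT⟩ := hη
  refine ⟨η, hη0, fun n hn S hS Y hY p hp => ?_⟩
  set μ : Measure ℝ≥0 := (D : Measure ℝ≥0) with hμ
  have hn' : (0 : ℝ) < n := by exact_mod_cast hn
  have hY0 : 0 ≤ Y := (abs_nonneg _).trans (hY 0 zero_le)
  have hV0 : 0 ≤ cellDeviation μ T S := supDeviation_nonneg _ _ _
  have hterm1 : 0 ≤ (ε * Y + 2 * H * cellDeviation μ T S) / n := by positivity
  have hterm2 : 0 ≤ 4 * (H : ℝ) ^ 2 / η * (Y / n) ^ 2 := by positivity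
  have hG : ∀ q, |empiricalRev S q - rev D q| ≤ H * (Y / n) := by
    intro q
    rcases le_or_gt q H with h | h
    · rw [empiricalRev_sub_rev D hn, abs_mul, abs_of_nonneg (by positivity)]
      calc (q : ℝ) / n * |deviation μ (Set.Ici q) S| ≤ H / n * Y := by
            gcongr
            exact hY q h
        _ = _ := by ring
    · have : empiricalRev S q = 0 := by
        have hc : (Finset.univ.filter fun i => q ≤ S i) = ∅ :=
          Finset.filter_eq_empty_iff.2 fun i _ => not_le.2 (lt_of_le_of_lt (hS i) h)
        simp [empiricalRev, hc]
      rw [this, rev_eq_zero hH h, sub_zero, abs_zero]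
      positivity
  have hfar : opt D - rev D p ≤ 2 * (H * (Y / n)) := by
    refine le_of_forall_pos_le_add fun θ hθ => ?_
    obtain ⟨q, -, hq⟩ := hnear θ hθ
    have h1 := (abs_le.1 (hG p)).2
    have h2 := (abs_le.1 (hG q)).1
    linarith [hp q]
  -- A loss of at least `η` is at most its square over `η`, which turns the first order bound `hfar`
  -- into a second order one.
  have hfar2 : η ≤ opt D - rev D p → opt D - rev D p ≤ 4 * (H : ℝ) ^ 2 / η * (Y / n) ^ 2 := by
    intro h
    have hg : 0 ≤ opt D - rev D p := hη0.le.trans h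
    calc opt D - rev D p ≤ (opt D - rev D p) * ((opt D - rev D p) / η) :=
          le_mul_of_one_le_right hg ((one_le_div hη0).2 h)
      _ ≤ (2 * (H * (Y / n))) * (2 * (H * (Y / n)) / η) := by gcongr
      _ = _ := by ring
  have hzero : rev D p = 0 → opt D - rev D p ≤ (ε * Y + 2 * H * cellDeviation μ T S) / n
      + 4 * (H : ℝ) ^ 2 / η * (Y / n) ^ 2 := by
    intro h0
    rcases hopt0.eq_or_lt with h | h
    · rw [h0, ← h]; simpa using add_nonneg hterm1 hterm2
    · have := hfar2 (by rw [h0, sub_zero]; exact hηopt h)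
      linarith
  rcases eq_or_ne p 0 with rfl | hp0
  · exact hzero (rev_zero D)
  rcases lt_or_ge H p with hpH | hpH
  · exact hzero (rev_eq_zero hH hpH)
  obtain ⟨j, hj, hjp, hps⟩ := hT2 p (pos_of_ne_zero hp0) hpH
  rcases hηT j hj with h | h
  · refine le_add_of_le_of_nonneg ?_ hterm2
    refine le_of_forall_pos_le_add fun θ hθ => ?_
    obtain ⟨q, ⟨hjq, hqH, hqs⟩, hq⟩ := h θ hθ
    -- The prices `p` and `q` share a cell, so the deviation of `[0, j]` cancels and only the parts
    -- inside the cell remain.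
    have hdiff : |deviation μ (Set.Ici p) S - deviation μ (Set.Ici q) S|
        ≤ 2 * cellDeviation μ T S := by
      rw [deviation_Ici, deviation_Ici, deviation_Iio_eq μ hjp hps, deviation_Iio_eq μ hjq hqs]
      have h1 := abs_le.1 (abs_deviation_le_cellDeviation μ S hj p)
      have h2 := abs_le.1 (abs_deviation_le_cellDeviation μ S hj q)
      rw [abs_le]
      constructor <;> linarith [h1.1, h1.2, h2.1, h2.2]
    have hosc : |p * deviation μ (Set.Ici p) S - q * deviation μ (Set.Ici q) S|
        ≤ ε * Y + 2 * H * cellDeviation μ T S := by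
      have : (p : ℝ) * deviation μ (Set.Ici p) S - q * deviation μ (Set.Ici q) S
          = (p - q) * deviation μ (Set.Ici p) S
            + q * (deviation μ (Set.Ici p) S - deviation μ (Set.Ici q) S) := by ring
      rw [this]
      refine (abs_add_le _ _).trans ?_
      rw [abs_mul, abs_mul, NNReal.abs_eq]
      have h1 : |(p : ℝ) - q| * |deviation μ (Set.Ici p) S| ≤ ε * Y :=
        mul_le_mul (hT3 j hj p q hjp hjq hpH hqH hps hqs) (hY p hpH) (abs_nonneg _) hε.le
      have h2 : (q : ℝ) * |deviation μ (Set.Ici p) S - deviation μ (Set.Ici q) S|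
          ≤ H * (2 * cellDeviation μ T S) :=
        mul_le_mul hqH hdiff (abs_nonneg _) H.2
      linarith
    have h1 := empiricalRev_sub_rev D hn S p
    have h2 := empiricalRev_sub_rev D hn S q
    have h3 : (empiricalRev S p - rev D p) - (empiricalRev S q - rev D q)
        ≤ (ε * Y + 2 * H * cellDeviation μ T S) / n := by
      rw [h1, h2, ← hμ, le_div_iff₀ hn']
      calc _ = p * deviation μ (Set.Ici p) S - q * deviation μ (Set.Ici q) S := by field_simp
        _ ≤ _ := (le_abs_self _).trans hosc
    linarith [hp q]
  · have := hfar2 (by linarith [h p ⟨hjp, hpH, hps⟩])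
    linarith

/-- Integrates `f ≤ b / 2 + f² / (2 b)`; the best `b` is the root mean square of `f`. -/
lemma integral_le_of_sq {Ω : Type*} [MeasurableSpace Ω] {P : Measure Ω} [IsProbabilityMeasure P]
    {f : Ω → ℝ} (hf : Integrable f P) (hf2 : Integrable (fun ω => f ω ^ 2) P) {b : ℝ} (hb : 0 < b) :
    ∫ ω, f ω ∂P ≤ (b + (∫ ω, f ω ^ 2 ∂P) / b) / 2 := by
  have h : ∀ ω, f ω ≤ b / 2 + f ω ^ 2 * (1 / (2 * b)) := fun ω => by
    have : b / 2 + f ω ^ 2 * (1 / (2 * b)) - f ω = (f ω - b) ^ 2 / (2 * b) := by field_simp; ring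
    have h2 : 0 ≤ (f ω - b) ^ 2 / (2 * b) := by positivity
    linarith
  have := integral_mono hf ((integrable_const (b / 2)).fun_add (hf2.mul_const (1 / (2 * b)))) h
  rw [integral_add (integrable_const _) (hf2.mul_const _), integral_mul_const] at this
  simp only [integral_const, probReal_univ, one_smul] at this
  refine this.trans (le_of_eq ?_)
  field_simp

/-- `C` does not depend on `ω`, so the coefficient of `1 / √n` can be made arbitrarily small; the
cost, through the cells and `η`, falls on the lower order term `K / n`. -/
lemma erm_revGap_le (hH : ∀ᵐ v ∂(D : Measure ℝ≥0), v ≤ H) {t : PricingAlgorithm} (ht : IsERM t) :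
    ∃ C : ℝ, 0 ≤ C ∧ ∀ ω : ℝ, 0 < ω → ω ≤ 1 / 2 → ∃ K : ℝ, 0 ≤ K ∧ ∀ n : ℕ, 0 < n →
      revGap t D n ≤ (C * ω) / √n + K / n := by
  set μ : Measure ℝ≥0 := (D : Measure ℝ≥0) with hμ
  obtain ⟨C, hC0, hC⟩ := exists_global_deviation μ hH
  refine ⟨(1 + C) / 2 + 50 * H, by positivity, fun ω hω hω2 => ?_⟩
  have hε : 0 < ω ^ 4 := by positivity
  have hω4 : ω ^ 4 ≤ ω := by
    have : ω ^ 4 ≤ ω ^ 1 := pow_le_pow_of_le_one hω.le (by linarith) (by norm_num)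
    simpa using this
  obtain ⟨T, hT1, hT2, hT3⟩ := exists_light_cells μ hH hε
  obtain ⟨η, hη, hgap⟩ := exists_erm_gap_le hH hε hT2 hT3
  refine ⟨16 * H / ω ^ 3 + 4 * (H : ℝ) ^ 2 / η * C, by positivity, fun n hn => ?_⟩
  have hn' : (0 : ℝ) < n := by exact_mod_cast hn
  set r := √(n : ℝ) with hr
  have hr0 : 0 < r := Real.sqrt_pos.2 hn'
  have hrn : (n : ℝ) = r ^ 2 := (Real.sq_sqrt hn'.le).symm
  set P := Measure.pi fun _ : Fin n => μ
  obtain ⟨Y, hYm, ⟨M, hM⟩, hY, hY2⟩ := hC n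
  have hVm := measurable_cellDeviation μ T n
  have hVb := abs_cellDeviation_le μ T (n := n)
  have hYi : Integrable Y P := integrable_of_bounded hYm M hM
  have hYi2 : Integrable (fun S => Y S ^ 2) P :=
    integrable_of_bounded (hYm.pow_const 2) (M ^ 2) fun S => by
      rw [abs_pow]; exact pow_le_pow_left₀ (abs_nonneg _) (hM S) 2
  have hVi : Integrable (cellDeviation μ T) P := integrable_of_bounded hVm n hVb
  have hVi2 : Integrable (fun S => cellDeviation μ T S ^ 2) P :=
    integrable_of_bounded (hVm.pow_const 2) ((n : ℝ) ^ 2) fun S => by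
      rw [abs_pow]; exact pow_le_pow_left₀ (abs_nonneg _) (hVb S) 2
  have hEY : ∫ S, Y S ∂P ≤ r * ((1 + C) / 2) := by
    refine (integral_le_of_sq hYi hYi2 hr0).trans ?_
    have : (∫ S, Y S ^ 2 ∂P) / r ≤ C * r := by
      rw [div_le_iff₀ hr0]; rw [hrn] at hY2; linarith
    linarith
  have hEV : ∫ S, cellDeviation μ T S ∂P ≤ 25 * ω * r + 8 / (ω ^ 3 * r) := by
    -- Cells of mass at most `ω ^ 4` and the level `a = ω ^ 2 * n` give `ω² n + 16 / ω² + 48 ω² n`.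
    have hV2 : ∫ S, cellDeviation μ T S ^ 2 ∂P ≤ 49 * ω ^ 2 * n + 16 / ω ^ 2 := by
      rcases T.eq_empty_or_nonempty with he | hne
      · subst he
        have : ∀ S : Fin n → ℝ≥0, cellDeviation μ ∅ S = 0 := fun S => Real.iSup_of_isEmpty _
        simp only [this]
        simp only [ne_eq, OfNat.ofNat_ne_zero, not_false_eq_true, zero_pow, integral_zero]
        positivity
      · refine (integral_cellDeviation_sq_le μ hne (by linarith) hT1 n (a := ω ^ 2 * n)
          (by positivity)).trans (le_of_eq ?_)
        field_simp
        ring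
    refine (integral_le_of_sq hVi hVi2 (b := ω * r) (by positivity)).trans ?_
    have : (∫ S, cellDeviation μ T S ^ 2 ∂P) / (ω * r) ≤ 49 * ω * r + 16 / (ω ^ 3 * r) := by
      rw [div_le_iff₀ (by positivity)]
      refine hV2.trans (le_of_eq ?_)
      rw [hrn]
      field_simp
    have e : 8 / (ω ^ 3 * r) = (16 / (ω ^ 3 * r)) / 2 := by ring
    rw [e]
    linarith
  have hY2i : Integrable (fun S => 4 * (H : ℝ) ^ 2 / η * (Y S / n) ^ 2) P := by
    simp_rw [div_pow]
    exact (hYi2.div_const _).const_mul _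
  have hΦ1 : Integrable (fun S => (ω ^ 4 * Y S + 2 * H * cellDeviation μ T S) / n) P :=
    ((hYi.const_mul _).add (hVi.const_mul _)).div_const _
  refine (revGap_le_integral hH t n (hΦ1.add hY2i) fun S hS => ?_).trans ?_
  · filter_upwards [ht n S] with p hp
    exact hgap n hn S hS (Y S) (hY S) p hp
  · simp only [Pi.add_apply]
    rw [integral_add hΦ1 hY2i, integral_div, integral_add (hYi.const_mul _) (hVi.const_mul _),
      integral_const_mul, integral_const_mul, integral_const_mul]
    simp_rw [div_pow]
    rw [integral_div]
    have h1 : (ω ^ 4 * ∫ S, Y S ∂P) + 2 * H * ∫ S, cellDeviation μ T S ∂P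
        ≤ ω * (r * ((1 + C) / 2)) + 2 * H * (25 * ω * r + 8 / (ω ^ 3 * r)) := by
      have h2 : ω ^ 4 * ∫ S, Y S ∂P ≤ ω * (r * ((1 + C) / 2)) := by
        calc ω ^ 4 * ∫ S, Y S ∂P ≤ ω ^ 4 * (r * ((1 + C) / 2)) := by gcongr
          _ ≤ _ := by gcongr
      gcongr
    have h3 : (∫ S, Y S ^ 2 ∂P) / (n : ℝ) ^ 2 ≤ C / n := by
      rw [div_le_div_iff₀ (by positivity) hn']
      nlinarith
    calc _ ≤ (ω * (r * ((1 + C) / 2)) + 2 * H * (25 * ω * r + 8 / (ω ^ 3 * r))) / n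
          + 4 * (H : ℝ) ^ 2 / η * (C / n) := by gcongr
      _ = ((1 + C) / 2 + 50 * H) * ω / r + (16 * H / ω ^ 3 / r + 4 * (H : ℝ) ^ 2 / η * C) / n := by
          rw [hrn]; field_simp; ring
      _ ≤ _ := by
          have hr1 : 1 ≤ r := by
            rw [hr, Real.one_le_sqrt]; exact_mod_cast hn
          have h4 : 16 * H / ω ^ 3 / r ≤ 16 * H / ω ^ 3 := div_le_self (by positivity) hr1
          gcongr

end EmpiricalRevenueMaximization

/-! ### From small multiples of the inverse square root to a rate -/

section Rates

lemma invSqrt_eq (n : ℕ) : invSqrt n = 1 / √(n : ℝ) := by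
  rw [invSqrt, Real.rpow_neg (Nat.cast_nonneg n), ← Real.sqrt_eq_rpow, one_div]

/-- The positive part of `a n`, multiplied by `√(n + 1)`, tends to zero. Tail suprema make it
antitone, adding `1 / (n + 1)` makes it positive, and dividing by `M + 1` brings it into `(0, 1]`.
The shift in `√(n + 1)` avoids a division by zero at `n = 0`. -/
lemma exists_rate {a : ℕ → ℝ} {B : ℝ} (hB : ∀ n, a n ≤ B)
    (ha : ∀ κ > 0, ∃ N : ℕ, ∀ n ≥ N, a n ≤ κ / √n) :
    ∃ g : ℕ → ℝ, IsRate g ∧ g =o[atTop] invSqrt ∧ ∃ C : ℝ, 0 < C ∧ ∀ n : ℕ, a n ≤ C * g n := by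
  let w : ℕ → ℝ := fun n => √((n : ℝ) + 1)
  have hw1 : ∀ n, 1 ≤ w n := fun n => by
    simp only [w, Real.one_le_sqrt]; linarith [(Nat.cast_nonneg n : (0 : ℝ) ≤ n)]
  have hw0 : ∀ n, 0 < w n := fun n => one_pos.trans_le (hw1 n)
  let b : ℕ → ℝ := fun n => max (a n) 0 * w n
  have hb0 : ∀ n, 0 ≤ b n := fun n => mul_nonneg (le_max_right _ _) (hw0 n).le
  have hbsmall : ∀ κ > 0, ∃ N : ℕ, ∀ n ≥ N, b n ≤ κ := by
    intro κ hκ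
    obtain ⟨N, hN⟩ := ha (κ / 2) (by positivity)
    refine ⟨max N 1, fun n hn => ?_⟩
    have hn1 : (1 : ℝ) ≤ n := by exact_mod_cast (le_max_right N 1).trans hn
    have hs : 0 < √(n : ℝ) := Real.sqrt_pos.2 (by linarith)
    have h1 : max (a n) 0 ≤ κ / 2 / √n := max_le (hN n ((le_max_left _ _).trans hn)) (by positivity)
    have h2 : w n ≤ 2 * √n := by
      simp only [w]
      rw [Real.sqrt_le_left (by positivity), mul_pow, Real.sq_sqrt (by linarith)]
      linarith
    calc b n ≤ κ / 2 / √n * (2 * √n) := mul_le_mul h1 h2 (hw0 n).le (by positivity)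
      _ = κ := by field_simp
  have hbdd : ∃ M, ∀ n, b n ≤ M := by
    obtain ⟨N, hN⟩ := hbsmall 1 one_pos
    refine ⟨max 1 (max B 0 * w N), fun n => ?_⟩
    rcases le_total N n with h | h
    · exact (hN n h).trans (le_max_left _ _)
    · refine le_trans (mul_le_mul (max_le_max_right 0 (hB n)) ?_ (hw0 n).le (le_max_right _ _))
        (le_max_right _ _)
      simp only [w]
      gcongr
  obtain ⟨M, hM⟩ := hbdd
  have hM0 : 0 ≤ M := (hb0 0).trans (hM 0)
  let s : ℕ → ℝ := fun n => ⨆ m, b (n + m)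
  have hsb : ∀ n, BddAbove (Set.range fun m => b (n + m)) := fun n =>
    ⟨M, by rintro _ ⟨m, rfl⟩; exact hM _⟩
  have hbs : ∀ n, b n ≤ s n := fun n => le_ciSup (hsb n) 0
  have hs0 : ∀ n, 0 ≤ s n := fun n => (hb0 n).trans (hbs n)
  have hsM : ∀ n, s n ≤ M := fun n => ciSup_le fun m => hM _
  have hsanti : Antitone s := fun k n hkn => ciSup_le fun m => by
    have h := le_ciSup (hsb k) (n - k + m)
    rwa [show k + (n - k + m) = n + m by omega] at h
  have hssmall : ∀ κ > 0, ∀ᶠ n in atTop, s n ≤ κ := fun κ hκ => by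
    obtain ⟨N, hN⟩ := hbsmall κ hκ
    filter_upwards [eventually_ge_atTop N] with n hn
    exact ciSup_le fun m => hN _ (by omega)
  let u : ℕ → ℝ := fun n => s n + 1 / ((n : ℝ) + 1)
  have hu0 : ∀ n, 0 < u n := fun n => add_pos_of_nonneg_of_pos (hs0 n) Nat.one_div_pos_of_nat
  have huanti : Antitone u := fun k n hkn => add_le_add (hsanti hkn) (Nat.one_div_le_one_div hkn)
  have hu1 : ∀ n, u n ≤ M + 1 := fun n => add_le_add (hsM n) (by
    rw [div_le_one (by positivity)]; linarith [(Nat.cast_nonneg n : (0 : ℝ) ≤ n)])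
  have husmall : Tendsto u atTop (𝓝 0) := by
    have h1 : Tendsto s atTop (𝓝 0) := by
      rw [Metric.tendsto_atTop']
      intro κ hκ
      obtain ⟨N, hN⟩ := eventually_atTop.1 (hssmall (κ / 2) (by positivity))
      refine ⟨N, fun n hn => ?_⟩
      rw [Real.dist_eq, sub_zero, abs_of_nonneg (hs0 n)]
      linarith [hN n hn.le]
    simpa [u] using h1.add tendsto_one_div_add_atTop_nhds_zero_nat
  have hwanti : ∀ k n, k ≤ n → w k ≤ w n := fun k n hkn => by
    simp only [w]; gcongr
  let g : ℕ → ℝ := fun n => u n / (M + 1) / w n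
  have hg0 : ∀ n, 0 < g n := fun n => div_pos (div_pos (hu0 n) (by linarith)) (hw0 n)
  have hgu : ∀ n, g n ≤ u n / (M + 1) := fun n =>
    div_le_self (div_pos (hu0 n) (by linarith)).le (hw1 n)
  refine ⟨g, ⟨fun n => ⟨hg0 n, (hgu n).trans ?_⟩, fun k n hkn => ?_, ?_⟩, ?_, M + 1, by linarith,
    fun n => ?_⟩
  · rw [div_le_one (by linarith)]; exact hu1 n
  · simp only [g]
    have := huanti hkn
    have := hwanti k n hkn
    have := hw0 k
    have := (hu0 k).le
    gcongr
  · refine squeeze_zero (fun n => (hg0 n).le) hgu ?_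
    simpa using husmall.div_const (M + 1)
  · rw [isLittleO_iff]
    intro c hc
    filter_upwards [husmall.eventually (ge_mem_nhds hc), eventually_gt_atTop 0] with n hn hn0
    have hn0' : (0 : ℝ) < n := by exact_mod_cast hn0
    rw [invSqrt_eq n, Real.norm_eq_abs, Real.norm_eq_abs, abs_of_pos (hg0 n),
      abs_of_pos (by positivity)]
    have hwn : √(n : ℝ) ≤ w n := by simp only [w]; gcongr; linarith
    have hs : 0 < √(n : ℝ) := Real.sqrt_pos.2 hn0'
    calc g n ≤ u n / w n := by
          simp only [g]
          have := hw0 n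
          gcongr
          exact div_le_self (hu0 n).le (by linarith)
      _ ≤ c / √n := by gcongr
      _ = c * (1 / √n) := by ring
  · have h1 : a n ≤ b n / w n := by
      simp only [b]
      rw [mul_div_cancel_right₀ _ (hw0 n).ne']
      exact le_max_left _ _
    have h2 : (M + 1) * g n = u n / w n := by
      simp only [g]; field_simp
    rw [h2]
    refine h1.trans ?_
    have := hw0 n
    have h3 : b n ≤ u n := (hbs n).trans (le_add_of_nonneg_right Nat.one_div_pos_of_nat.le)
    gcongr

/-- Given `κ`, first `ω` is chosen with `C ω ≤ κ / 2`, and then `n` so large that `K / n` is at most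
`κ / 2 / √n`. The finitely many smaller `n` only need the bound `H`. -/
theorem IsERM.achievesLittleO {t : PricingAlgorithm} (ht : IsERM t) :
    AchievesLittleO t boundedSupport invSqrt := by
  rintro D ⟨H, hH⟩
  refine exists_rate (B := H) (fun n => ?_) fun κ hκ => ?_
  · have h1 : opt D ≤ H := opt_le_of_forall (rev_le hH)
    have h2 : 0 ≤ expectedRev t D n := integral_nonneg fun S => integral_rev_nonneg t n S
    unfold revGap
    linarith
  obtain ⟨C, hC, h⟩ := erm_revGap_le hH ht
  set ω : ℝ := min (1 / 2) (κ / 2 / (C + 1)) with hω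
  have hω0 : 0 < ω := by rw [hω]; positivity
  have hCω : C * ω ≤ κ / 2 := by
    calc C * ω ≤ (C + 1) * (κ / 2 / (C + 1)) :=
          mul_le_mul (by linarith) (min_le_right _ _) hω0.le (by linarith)
      _ = κ / 2 := by field_simp
  obtain ⟨K, hK, hn⟩ := h ω hω0 (min_le_left _ _)
  obtain ⟨N, hN⟩ := exists_nat_gt ((2 * K / κ) ^ 2)
  refine ⟨max N 1, fun n hn' => (hn n ((le_max_right N 1).trans hn')).trans ?_⟩
  have hn0 : (0 : ℝ) < n := by exact_mod_cast (le_max_right N 1).trans hn'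
  have hs : 0 < √(n : ℝ) := Real.sqrt_pos.2 hn0
  have hsN : 2 * K / κ ≤ √(n : ℝ) := by
    apply Real.le_sqrt_of_sq_le
    exact hN.le.trans (by exact_mod_cast (le_max_left N 1).trans hn')
  have h1 : K / n ≤ κ / 2 / √n := by
    rw [div_le_div_iff₀ hn0 hs]
    rw [div_le_iff₀ hκ] at hsN
    have h2 : (n : ℝ) = √n * √n := (Real.mul_self_sqrt hn0.le).symm
    rw [h2]
    simp only [← h2]
    nlinarith
  calc C * ω / √n + K / n ≤ κ / 2 / √n + κ / 2 / √n := by gcongr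
    _ = κ / √n := by ring

end Rates

/-! ### Existence of a measurable empirical maximizer -/

section Existence

/-- Candidates are added one at a time, carrying the running maximum `E` along with its argument so
that each comparison is between measurable functions. -/
lemma exists_measurable_argmax {Ω β ι : Type*} [MeasurableSpace Ω] [MeasurableSpace β]
    {e : ι → Ω → ℝ} (he : ∀ i, Measurable (e i)) {x : ι → Ω → β} (hx : ∀ i, Measurable (x i))
    {s : Finset ι} (hs : s.Nonempty) :
    ∃ (f : Ω → β) (E : Ω → ℝ), Measurable f ∧ Measurable E ∧
      ∀ ω, ∃ i ∈ s, f ω = x i ω ∧ E ω = e i ω ∧ ∀ j ∈ s, e j ω ≤ E ω := by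
  classical
  induction hs using Finset.Nonempty.cons_induction with
  | singleton a => exact ⟨x a, e a, hx a, he a, fun ω => ⟨a, by simp, rfl, rfl, by simp⟩⟩
  | cons a s ha hs ih =>
    obtain ⟨f, E, hf, hE, h⟩ := ih
    refine ⟨fun ω => if E ω ≤ e a ω then x a ω else f ω, fun ω => if E ω ≤ e a ω then e a ω else E ω,
      (hx a).ite (measurableSet_le hE (he a)) hf, (he a).ite (measurableSet_le hE (he a)) hE,
      fun ω => ?_⟩
    obtain ⟨i, hi, h1, h2, h3⟩ := h ω
    by_cases hle : E ω ≤ e a ω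
    · refine ⟨a, by simp, by simp [hle], by simp [hle], fun j hj => ?_⟩
      rcases Finset.mem_cons.1 hj with rfl | hj
      · simp [hle]
      · simpa [hle] using (h3 j hj).trans hle
    · refine ⟨i, by simp [hi], by simp [hle, h1], by rw [← h2]; exact if_neg hle, fun j hj => ?_⟩
      rcases Finset.mem_cons.1 hj with rfl | hj
      · simpa [hle] using (not_le.1 hle).le
      · simpa [hle] using h3 j hj

/-- Raising the price to the smallest sample above it loses no buyer. This reduces the maximization
to finitely many candidates. -/
lemma exists_sample_empiricalRev_le {n : ℕ} (hn : 0 < n) (S : Fin n → ℝ≥0) (q : ℝ≥0) :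
    ∃ i, empiricalRev S q ≤ empiricalRev S (S i) := by
  rcases (Finset.univ.filter fun i => q ≤ S i).eq_empty_or_nonempty with h | h
  · refine ⟨⟨0, hn⟩, ?_⟩
    have : empiricalRev S q = 0 := by simp [empiricalRev, h]
    rw [this, empiricalRev]
    positivity
  · obtain ⟨i, hi, hmin⟩ := Finset.exists_min_image _ S h
    refine ⟨i, ?_⟩
    have hqi : q ≤ S i := (Finset.mem_filter.1 hi).2
    have hf : (Finset.univ.filter fun k => q ≤ S k) = Finset.univ.filter fun k => S i ≤ S k := by
      ext k
      simp only [Finset.mem_filter, Finset.mem_univ, true_and]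
      exact ⟨fun hk => hmin k (by simp [hk]), hqi.trans⟩
    rw [empiricalRev, empiricalRev, hf]
    gcongr

lemma measurable_empiricalRev_sample {n : ℕ} (i : Fin n) :
    Measurable fun S : Fin n → ℝ≥0 => empiricalRev S (S i) := by
  have h : ∀ S : Fin n → ℝ≥0, empiricalRev S (S i)
      = (S i : ℝ) * ((∑ k, if S i ≤ S k then (1 : ℝ) else 0) / n) := fun S => by
    simp [empiricalRev]
  simp_rw [h]
  refine (measurable_coe_nnreal_real.comp (measurable_pi_apply i)).mul (Measurable.div_const ?_ _)
  exact Finset.measurable_sum _ fun k _ => Measurable.ite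
    (measurableSet_le (measurable_pi_apply i) (measurable_pi_apply k)) measurable_const measurable_const

lemma exists_measurable_maximizer (n : ℕ) :
    ∃ f : (Fin n → ℝ≥0) → ℝ≥0, Measurable f ∧ ∀ S q, empiricalRev S q ≤ empiricalRev S (f S) := by
  rcases Nat.eq_zero_or_pos n with rfl | hn
  -- Division by zero makes the empirical revenue identically zero, so every price is a maximizer.
  · exact ⟨fun _ => 0, measurable_const, fun S q => by simp [empiricalRev]⟩
  have : Nonempty (Fin n) := ⟨⟨0, hn⟩⟩
  obtain ⟨f, E, hf, -, h⟩ := exists_measurable_argmax (fun i => measurable_empiricalRev_sample i)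
    (x := fun (i : Fin n) (S : Fin n → ℝ≥0) => S i) (fun i => measurable_pi_apply i)
    Finset.univ_nonempty
  refine ⟨f, hf, fun S q => ?_⟩
  obtain ⟨i, -, h1, h2, h3⟩ := h S
  obtain ⟨k, hk⟩ := exists_sample_empiricalRev_le hn S q
  rw [h1, ← h2]
  exact hk.trans (h3 k (Finset.mem_univ k))

theorem exists_isERM : ∃ t : PricingAlgorithm, IsERM t := by
  choose f hf h using exists_measurable_maximizer
  refine ⟨⟨fun n => Kernel.deterministic (f n) (hf n), fun n => inferInstance⟩, fun n S => ?_⟩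
  simp only [Kernel.deterministic_apply]
  rw [ae_dirac_eq]
  exact h n S

end Existence

/-! ### Change of density and the two-point bound -/

section Tilting

/-- A measurable density with values in `[0, 2]`. -/
structure IsDensity (D : ValuationDist) (g : ℝ≥0 → ℝ) : Prop where
  measurable : Measurable g
  nonneg : ∀ v, 0 ≤ g v
  le_two : ∀ v, g v ≤ 2
  integral_eq_one : ∫ v, g v ∂(D : Measure ℝ≥0) = 1

variable {D : ValuationDist} {g : ℝ≥0 → ℝ}

lemma IsDensity.abs_le (hg : IsDensity D g) (v : ℝ≥0) : |g v| ≤ 2 := by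
  rw [abs_of_nonneg (hg.nonneg v)]; exact hg.le_two v

lemma IsDensity.integrable (hg : IsDensity D g) : Integrable g (D : Measure ℝ≥0) :=
  integrable_of_bounded hg.measurable 2 hg.abs_le

/-- The distribution with density `g` with respect to `D`. -/
noncomputable def tilt (D : ValuationDist) (g : ℝ≥0 → ℝ) (hg : IsDensity D g) : ValuationDist :=
  ⟨(D : Measure ℝ≥0).withDensity fun v => ENNReal.ofReal (g v),
    ⟨by
      rw [withDensity_apply _ MeasurableSet.univ, Measure.restrict_univ,
        ← ofReal_integral_eq_lintegral_ofReal hg.integrable (Eventually.of_forall hg.nonneg),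
        hg.integral_eq_one, ENNReal.ofReal_one]⟩⟩

lemma coe_tilt (hg : IsDensity D g) : ((tilt D g hg : ValuationDist) : Measure ℝ≥0)
    = (D : Measure ℝ≥0).withDensity fun v => ENNReal.ofReal (g v) := rfl

lemma tilt_real (hg : IsDensity D g) {A : Set ℝ≥0} (hA : MeasurableSet A) :
    ((tilt D g hg : ValuationDist) : Measure ℝ≥0).real A = ∫ v in A, g v ∂(D : Measure ℝ≥0) := by
  rw [coe_tilt, measureReal_def, withDensity_apply _ hA,
    ← ofReal_integral_eq_lintegral_ofReal hg.integrable.integrableOn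
      (Eventually.of_forall hg.nonneg),
    ENNReal.toReal_ofReal (integral_nonneg hg.nonneg)]

lemma tilt_ae (hg : IsDensity D g) {p : ℝ≥0 → Prop} (h : ∀ᵐ v ∂(D : Measure ℝ≥0), p v) :
    ∀ᵐ v ∂((tilt D g hg : ValuationDist) : Measure ℝ≥0), p v :=
  (withDensity_absolutelyContinuous _ _).ae_le h

lemma integral_tilt (hg : IsDensity D g) (F : ℝ≥0 → ℝ) :
    ∫ v, F v ∂((tilt D g hg : ValuationDist) : Measure ℝ≥0)
      = ∫ v, g v * F v ∂(D : Measure ℝ≥0) := by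
  rw [coe_tilt, integral_withDensity_eq_integral_toReal_smul hg.measurable.ennreal_ofReal
    (Eventually.of_forall fun _ => ENNReal.ofReal_lt_top)]
  refine integral_congr_ae (Eventually.of_forall fun v => ?_)
  simp [ENNReal.toReal_ofReal (hg.nonneg v)]

lemma measurable_prod_density (hg : IsDensity D g) (n : ℕ) :
    Measurable fun S : Fin n → ℝ≥0 => ∏ i, g (S i) :=
  Finset.measurable_prod _ fun i _ => hg.measurable.comp (measurable_pi_apply i)

lemma prod_density_nonneg (hg : IsDensity D g) {n : ℕ} (S : Fin n → ℝ≥0) : 0 ≤ ∏ i, g (S i) :=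
  Finset.prod_nonneg fun _ _ => hg.nonneg _

lemma prod_density_le (hg : IsDensity D g) {n : ℕ} (S : Fin n → ℝ≥0) : ∏ i, g (S i) ≤ 2 ^ n :=
  (Finset.prod_le_prod (fun _ _ => hg.nonneg _) fun _ _ => hg.le_two _).trans (by simp)

lemma integrable_prod_density (hg : IsDensity D g) (n : ℕ) :
    Integrable (fun S : Fin n → ℝ≥0 => ∏ i, g (S i)) (Measure.pi fun _ : Fin n => (D : Measure ℝ≥0)) :=
  integrable_of_bounded (measurable_prod_density hg n) (2 ^ n) fun S => by
    rw [abs_of_nonneg (prod_density_nonneg hg S)]; exact prod_density_le hg S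

lemma integral_prod_density (hg : IsDensity D g) (n : ℕ) :
    ∫ S : Fin n → ℝ≥0, ∏ i, g (S i) ∂(Measure.pi fun _ : Fin n => (D : Measure ℝ≥0)) = 1 := by
  rw [integral_fintype_prod_eq_prod (f := fun (_ : Fin n) => g)
    (μ := fun _ : Fin n => (D : Measure ℝ≥0))]
  simp [hg.integral_eq_one]

lemma pi_tilt (hg : IsDensity D g) (n : ℕ) :
    (Measure.pi fun _ : Fin n => ((tilt D g hg : ValuationDist) : Measure ℝ≥0))
      = (Measure.pi fun _ : Fin n => (D : Measure ℝ≥0)).withDensity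
          fun S => ENNReal.ofReal (∏ i, g (S i)) := by
  refine Measure.pi_eq fun s hs => ?_
  have hpi : MeasurableSet (Set.univ.pi s) := MeasurableSet.univ_pi hs
  rw [withDensity_apply _ hpi, ← ofReal_integral_eq_lintegral_ofReal
    (integrable_prod_density hg n).integrableOn
    (Eventually.of_forall fun S => prod_density_nonneg hg S), ← integral_indicator hpi]
  have h : ∀ S : Fin n → ℝ≥0, (Set.univ.pi s).indicator (fun S => ∏ i, g (S i)) S
      = ∏ i, (s i).indicator g (S i) := fun S => by
    by_cases hS : S ∈ Set.univ.pi s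
    · rw [Set.indicator_of_mem hS]
      exact Finset.prod_congr rfl fun i _ => (Set.indicator_of_mem (hS i (Set.mem_univ i)) g).symm
    · rw [Set.indicator_of_notMem hS]
      simp only [Set.mem_pi, Set.mem_univ, true_implies, not_forall] at hS
      obtain ⟨i, hi⟩ := hS
      exact (Finset.prod_eq_zero (Finset.mem_univ i) (Set.indicator_of_notMem hi g)).symm
  simp_rw [h]
  rw [integral_fintype_prod_eq_prod (f := fun (i : Fin n) => (s i).indicator g)
    (μ := fun _ : Fin n => (D : Measure ℝ≥0)),
    ENNReal.ofReal_prod_of_nonneg fun i _ => integral_nonneg fun v =>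
      Set.indicator_nonneg (fun v _ => hg.nonneg v) v]
  refine Finset.prod_congr rfl fun i _ => ?_
  rw [integral_indicator (hs i), ← tilt_real hg (hs i), ofReal_measureReal]

lemma integral_pi_tilt (hg : IsDensity D g) (n : ℕ) (F : (Fin n → ℝ≥0) → ℝ) :
    ∫ S, F S ∂(Measure.pi fun _ : Fin n => ((tilt D g hg : ValuationDist) : Measure ℝ≥0))
      = ∫ S, (∏ i, g (S i)) * F S ∂(Measure.pi fun _ : Fin n => (D : Measure ℝ≥0)) := by
  rw [pi_tilt, integral_withDensity_eq_integral_toReal_smul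
    (measurable_prod_density hg n).ennreal_ofReal
    (Eventually.of_forall fun _ => ENNReal.ofReal_lt_top)]
  refine integral_congr_ae (Eventually.of_forall fun S => ?_)
  simp only [ENNReal.toReal_ofReal (prod_density_nonneg hg S), smul_eq_mul]

/-- For `a ≤ b` one has `a ≥ (3 / 4) / b`, and `1 / b ≥ 1 - b / 4` is `(b / 2 - 1)² ≥ 0`. The bound
is affine in `a + b`, so for likelihood ratios, of mean one, it integrates to `3 / 8`. -/
lemma min_ge_of_mul_ge {a b : ℝ} (ha : 0 ≤ a) (hb : 0 ≤ b) (hab : 3 / 4 ≤ a * b) :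
    3 / 4 * (1 - (a + b) / 4) ≤ min a b := by
  wlog h : a ≤ b generalizing a b
  · rw [add_comm, min_comm]
    exact this hb ha (by rwa [mul_comm]) (le_of_not_ge h)
  rw [min_eq_left h]
  have hb0 : 0 < b := by
    rcases hb.eq_or_lt with h0 | h0
    · rw [← h0] at hab; norm_num at hab
    · exact h0
  have h1 : 3 / 4 / b ≤ a := by rw [div_le_iff₀ hb0]; exact hab
  have h2 : 3 / 4 * (1 - b / 4) ≤ 3 / 4 / b := by
    rw [le_div_iff₀ hb0]; nlinarith [sq_nonneg (b / 2 - 1)]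
  linarith

/-- Two-point lower bound: no estimator distinguishes the tilts `1 + h` and `1 - h` of `D` when
`n · sup h² ≤ 1 / 4`. -/
lemma two_point_bound {h : ℝ≥0 → ℝ} {b : ℝ} (hb : ∀ v, |h v| ≤ b)
    (hp : IsDensity D fun v => 1 + h v) (hm : IsDensity D fun v => 1 - h v) {n : ℕ}
    (hn : n * b ^ 2 ≤ 1 / 4) {Fp Fm : (Fin n → ℝ≥0) → ℝ} (hFp : Measurable Fp) (hFm : Measurable Fm)
    {K : ℝ} (hFp0 : ∀ S, 0 ≤ Fp S) (hFm0 : ∀ S, 0 ≤ Fm S) (hFpK : ∀ S, Fp S ≤ K)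
    (hFmK : ∀ S, Fm S ≤ K) {ε : ℝ} (hε : 0 ≤ ε) (hsum : ∀ S, ε ≤ Fp S + Fm S) :
    3 / 8 * ε ≤ ∫ S, Fp S ∂(Measure.pi fun _ : Fin n => ((tilt D _ hp : ValuationDist) : Measure ℝ≥0))
      + ∫ S, Fm S ∂(Measure.pi fun _ : Fin n => ((tilt D _ hm : ValuationDist) : Measure ℝ≥0)) := by
  -- Without samples `hn` says nothing about `b`, but there is then a single sample point and `hsum`
  -- applies directly.
  rcases Nat.eq_zero_or_pos n with rfl | hn0
  · have e : ∀ F : (Fin 0 → ℝ≥0) → ℝ, ∀ ν : Measure ℝ≥0, ∀ S, IsProbabilityMeasure ν →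
        ∫ S, F S ∂(Measure.pi fun _ : Fin 0 => ν) = F S := fun F ν S _ => by
      simp_rw [Subsingleton.elim _ S]; simp
    rw [e Fp _ (fun _ => 0) inferInstance, e Fm _ (fun _ => 0) inferInstance]
    linarith [hsum fun _ => 0]
  have hb1 : b ^ 2 ≤ 1 := by
    have : (1 : ℝ) ≤ n := by exact_mod_cast hn0
    nlinarith [sq_nonneg b]
  rw [integral_pi_tilt, integral_pi_tilt]
  set P := Measure.pi fun _ : Fin n => (D : Measure ℝ≥0)
  set a : (Fin n → ℝ≥0) → ℝ := fun S => ∏ i, (1 + h (S i))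
  set c : (Fin n → ℝ≥0) → ℝ := fun S => ∏ i, (1 - h (S i))
  have ha0 : ∀ S, 0 ≤ a S := fun S => prod_density_nonneg hp S
  have hc0 : ∀ S, 0 ≤ c S := fun S => prod_density_nonneg hm S
  -- The factors pair up to `1 - h ^ 2`, and Bernoulli's inequality bounds their product below by `1
  -- - n b ^ 2`.
  have hac : ∀ S, 3 / 4 ≤ a S * c S := fun S => by
    simp only [a, c]
    rw [← Finset.prod_mul_distrib]
    calc (3 / 4 : ℝ) ≤ 1 + n * (-b ^ 2) := by linarith
      _ ≤ (1 + -b ^ 2) ^ n := one_add_mul_le_pow (by linarith) n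
      _ = ∏ _i : Fin n, (1 + -b ^ 2) := by simp
      _ ≤ _ := by
          refine Finset.prod_le_prod (fun _ _ => by linarith) fun i _ => ?_
          have h1 : h (S i) ^ 2 ≤ b ^ 2 := sq_le_sq.2 ((hb _).trans (le_abs_self b))
          nlinarith
  have hai : Integrable a P := integrable_prod_density hp n
  have hci : Integrable c P := integrable_prod_density hm n
  have hmul : ∀ {g : ℝ≥0 → ℝ}, IsDensity D g → ∀ {F : (Fin n → ℝ≥0) → ℝ}, Measurable F →
      (∀ S, 0 ≤ F S) → (∀ S, F S ≤ K) → Integrable (fun S => (∏ i, g (S i)) * F S) P := by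
    intro g hg F hF h0 hK
    refine integrable_of_bounded ((measurable_prod_density hg n).mul hF) (2 ^ n * K) fun S => ?_
    rw [abs_mul, abs_of_nonneg (prod_density_nonneg hg S), abs_of_nonneg (h0 S)]
    exact mul_le_mul (prod_density_le hg S) (hK S) (h0 S) (by positivity)
  have h1 : ∫ S, ε * (3 / 4 * (1 - (a S + c S) / 4)) ∂P ≤ ∫ S, (a S * Fp S + c S * Fm S) ∂P := by
    refine integral_mono ?_ ((hmul hp hFp hFp0 hFpK).add (hmul hm hFm hFm0 hFmK)) fun S => ?_
    · exact (((integrable_const _).sub ((hai.add hci).div_const 4)).const_mul _).const_mul _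
    · have h2 := min_ge_of_mul_ge (ha0 S) (hc0 S) (hac S)
      have h3 : 0 ≤ min (a S) (c S) := le_min (ha0 S) (hc0 S)
      calc ε * (3 / 4 * (1 - (a S + c S) / 4)) ≤ ε * min (a S) (c S) := by gcongr
        _ ≤ (Fp S + Fm S) * min (a S) (c S) := by gcongr; exact hsum S
        _ = min (a S) (c S) * Fp S + min (a S) (c S) * Fm S := by ring
        _ ≤ a S * Fp S + c S * Fm S := by
          have := hFp0 S
          have := hFm0 S
          gcongr
          · exact min_le_left _ _
          · exact min_le_right _ _
  rw [integral_add (hmul hp hFp hFp0 hFpK) (hmul hm hFm hFm0 hFmK)] at h1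
  refine le_trans (le_of_eq ?_) h1
  rw [integral_const_mul, integral_const_mul, integral_sub (integrable_const _)
    ((hai.fun_add hci).div_const 4), integral_div, integral_add hai hci]
  simp only [a, c]
  rw [integral_prod_density hp, integral_prod_density hm]
  simp
  ring

end Tilting

/-! ### Perturbing a revenue plateau -/

section Perturbation

variable {D : ValuationDist}

/-- The revenue curve is constant and maximal on an interval of positive prices. -/
def HasOptimalPlateau (D : ValuationDist) (x y : ℝ≥0) (r : ℝ) : Prop :=
  0 < x ∧ x < y ∧ 0 < r ∧ (∀ p, x ≤ p → p ≤ y → rev D p = r) ∧ ∀ p, rev D p ≤ r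

lemma HasOptimalPlateau.opt_eq (hD : ∀ᵐ v ∂(D : Measure ℝ≥0), v ≤ 1) {x y : ℝ≥0} {r : ℝ}
    (h : HasOptimalPlateau D x y r) : opt D = r :=
  le_antisymm (opt_le_of_forall h.2.2.2.2)
    ((h.2.2.2.1 x le_rfl h.2.1.le).symm.trans_le (rev_le_opt hD x))

/-- A plateau carries a perturbation whose effect on revenue is a trapezoid: `0` on one part of the
plateau and `1` on another. -/
lemma HasOptimalPlateau.exists_bump {x y : ℝ≥0} {r : ℝ} (h : HasOptimalPlateau D x y r) :
    ∃ (k : ℝ≥0 → ℝ) (w : ℝ≥0 → ℝ) (L : ℝ) (x₁ y₁ x₂ : ℝ≥0), Measurable k ∧ 0 < L ∧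
      (∀ v, |k v| ≤ L) ∧ ∫ v, k v ∂(D : Measure ℝ≥0) = 0 ∧
      (∀ p : ℝ≥0, p * ∫ v in Set.Ici p, k v ∂(D : Measure ℝ≥0) = w p) ∧
      (∀ p, 0 ≤ w p ∧ w p ≤ 1) ∧ x ≤ x₁ ∧ x₁ < y₁ ∧ y₁ ≤ y ∧ x ≤ x₂ ∧ x₂ < y ∧
      (∀ p, x₁ ≤ p → p ≤ y₁ → w p = 1) ∧ ∀ p, x₂ ≤ p → p ≤ y → w p = 0 := by
  obtain ⟨hx, hxy, hr, hplat, -⟩ := h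
  set μ : Measure ℝ≥0 := (D : Measure ℝ≥0) with hμ
  set d : ℝ≥0 := (y - x) / 4 with hd
  have hd0 : 0 < d := div_pos (tsub_pos_of_lt hxy) (by norm_num)
  have hd0' : (0 : ℝ) < d := hd0
  have hx' : (0 : ℝ) < x := hx
  have hy : (y : ℝ) = x + 4 * d := by
    rw [hd, NNReal.coe_div, NNReal.coe_sub hxy.le]; push_cast; ring
  let s : Fin 4 → ℝ≥0 := fun l => x + (l : ℕ) * d
  have hs : ∀ l : Fin 4, (s l : ℝ) = x + (l : ℕ) * d := fun l => by simp [s]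
  have hs0 : ∀ l, (0 : ℝ) < s l := fun l => by rw [hs]; positivity
  have hxs : ∀ l, x ≤ s l := fun l => le_self_add
  have hsy : ∀ l, s l ≤ y := fun l => by
    rw [← NNReal.coe_le_coe, hs, hy]
    have : ((l : ℕ) : ℝ) ≤ 4 := by exact_mod_cast l.2.le
    nlinarith
  -- The coefficients `β` are chosen so that `∑ β l * min p (s l)` is a trapezoid: it rises on `[s
  -- 0, s 1]`, equals `1` on `[s 1, s 2]`, and falls to `0` at `s 3`. On the plateau the tail mass
  -- at `s l` is `r / s l`, so the weight `s l / r` in `α` turns a step at `s l` into the revenue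
  -- change `min p (s l)`. Then `∑ β = 0` gives `k` mean zero, and `∑ β s = 0` removes any effect
  -- beyond `y`.
  let β : Fin 4 → ℝ := ![-1 / d, 1 / d, 1 / d, -1 / d]
  let α : Fin 4 → ℝ := fun l => β l * s l / r
  let k : ℝ≥0 → ℝ := fun v => ∑ l, α l * (Set.Ici (s l)).indicator (fun _ => (1 : ℝ)) v
  have hβ0 : ∑ l, β l = 0 := by
    simp [β, Fin.sum_univ_four]; field_simp; ring
  have hβ1 : ∑ l, β l * s l = 0 := by
    simp only [Fin.sum_univ_four, hs]; simp [β]; ring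
  let W : ℝ → ℝ := fun p => ∑ l, β l * min p (s l)
  let w : ℝ≥0 → ℝ := fun p => if p ≤ y then W p else 0
  have hW : ∀ p : ℝ, W p * d = -min p x + min p (x + d) + min p (x + 2 * d) - min p (x + 3 * d) := by
    intro p
    simp only [W, Fin.sum_univ_four, hs]
    simp [β]
    field_simp
    ring
  have hkm : Measurable k := Finset.measurable_sum _ fun l _ =>
    (measurable_const.indicator measurableSet_Ici).const_mul _
  have hki : ∀ p : ℝ≥0, ∫ v in Set.Ici p, k v ∂μ = ∑ l, α l * μ.real (Set.Ici (max p (s l))) := by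
    intro p
    simp only [k]
    rw [integral_finsetSum _ fun l _ =>
      ((integrable_const (1 : ℝ)).indicator measurableSet_Ici).const_mul (α l)]
    refine Finset.sum_congr rfl fun l _ => ?_
    rw [integral_const_mul, integral_indicator measurableSet_Ici,
      Measure.restrict_restrict measurableSet_Ici, Set.Ici_inter_Ici, sup_comm]
    simp
  have hsr : ∀ l, (s l : ℝ) * μ.real (Set.Ici (s l)) = r := fun l => hplat (s l) (hxs l) (hsy l)
  have hterm : ∀ p ≤ y, ∀ l, (p : ℝ) * (α l * μ.real (Set.Ici (max p (s l)))) = β l * min (p : ℝ) (s l) := by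
    intro p hp l
    have := hs0 l
    simp only [α]
    rcases le_total p (s l) with hps | hps
    · rw [max_eq_right hps, min_eq_left (by exact_mod_cast hps)]
      calc _ = β l * p * (s l * μ.real (Set.Ici (s l))) / r := by ring
        _ = _ := by rw [hsr]; field_simp
    · rw [max_eq_left hps, min_eq_right (by exact_mod_cast hps)]
      have hpr : (p : ℝ) * μ.real (Set.Ici p) = r := hplat p ((hxs l).trans hps) hp
      calc _ = β l * s l * (p * μ.real (Set.Ici p)) / r := by ring
        _ = _ := by rw [hpr]; field_simp
  have hk0 : ∫ v, k v ∂μ = 0 := by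
    have h1 := hki 0
    have hu : Set.Ici (0 : ℝ≥0) = Set.univ := Set.eq_univ_of_forall fun _ => Set.mem_Ici.2 zero_le
    rw [hu, Measure.restrict_univ] at h1
    rw [h1, ← hβ0]
    refine Finset.sum_congr rfl fun l _ => ?_
    rw [max_eq_right zero_le]
    calc α l * μ.real (Set.Ici (s l)) = β l * (s l * μ.real (Set.Ici (s l))) / r := by
          simp only [α]; ring
      _ = β l := by rw [hsr]; field_simp
  have hrev : ∀ p : ℝ≥0, p * ∫ v in Set.Ici p, k v ∂μ = w p := by
    intro p
    rw [hki, Finset.mul_sum]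
    simp only [w]
    split_ifs with hp
    · exact Finset.sum_congr rfl fun l _ => hterm p hp l
    · have hp' : y ≤ p := (not_le.1 hp).le
      have : ∀ l, (p : ℝ) * (α l * μ.real (Set.Ici (max p (s l))))
          = (p * μ.real (Set.Ici p) / r) * (β l * s l) := fun l => by
        rw [max_eq_left ((hsy l).trans hp')]
        simp only [α]; ring
      rw [Finset.sum_congr rfl fun l _ => this l, ← Finset.mul_sum, hβ1, mul_zero]
  have hw01 : ∀ p, 0 ≤ w p ∧ w p ≤ 1 := by
    intro p
    simp only [w]
    split_ifs with hp
    · have h1 := hW p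
      have h2 : 0 ≤ W p * d ∧ W p * d ≤ 1 * d := by
        rw [h1]
        rcases le_total (p : ℝ) x with a | a <;> rcases le_total (p : ℝ) (x + d) with b | b <;>
        rcases le_total (p : ℝ) (x + 2 * d) with c | c <;>
        rcases le_total (p : ℝ) (x + 3 * d) with e | e <;>
        simp only [min_eq_left, min_eq_right, a, b, c, e] <;> constructor <;> linarith
      exact ⟨nonneg_of_mul_nonneg_left h2.1 hd0', le_of_mul_le_mul_right h2.2 hd0'⟩
    · simp
  refine ⟨k, w, ∑ l, |α l| + 1, s 1, s 2, s 3, hkm, by positivity, fun v => ?_, hk0, hrev, hw01,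
    hxs 1, ?_, hsy 2, hxs 3, ?_, fun p h1 h2 => ?_, fun p h1 h2 => ?_⟩
  · refine (Finset.abs_sum_le_sum_abs _ _).trans (le_add_of_le_of_nonneg ?_ zero_le_one)
    refine Finset.sum_le_sum fun l _ => ?_
    rw [abs_mul]
    refine mul_le_of_le_one_right (abs_nonneg _) ?_
    by_cases hv : v ∈ Set.Ici (s l) <;> simp [hv]
  · rw [← NNReal.coe_lt_coe, hs, hs]; norm_num; linarith
  · rw [← NNReal.coe_lt_coe, hs, hy]; norm_num; linarith
  · rw [← NNReal.coe_le_coe, hs] at h1 h2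
    norm_num at h1 h2
    have hpy : p ≤ y := by rw [← NNReal.coe_le_coe, hy]; linarith
    have h3 := hW p
    rw [min_eq_right (by linarith), min_eq_right (by linarith), min_eq_left (by linarith),
      min_eq_left (by linarith)] at h3
    simp only [w, hpy, if_true]
    have : W p * d = 1 * d := by linarith
    exact mul_right_cancel₀ hd0'.ne' this
  · rw [← NNReal.coe_le_coe, hs] at h1
    norm_num at h1
    have h3 := hW p
    rw [min_eq_right (by linarith), min_eq_right (by linarith), min_eq_right (by linarith),
      min_eq_right (by linarith)] at h3
    simp only [w, h2, if_true]
    have : W p * d = 0 * d := by linarith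
    exact mul_right_cancel₀ hd0'.ne' this

lemma rev_tilt {g : ℝ≥0 → ℝ} (hg : IsDensity D g) (p : ℝ≥0) :
    rev (tilt D g hg) p = p * ∫ v in Set.Ici p, g v ∂(D : Measure ℝ≥0) := by
  rw [rev, tilt_real hg measurableSet_Ici]

lemma tilt_tilt {g f fg : ℝ≥0 → ℝ} (hg : IsDensity D g) (hf : IsDensity (tilt D g hg) f)
    (hfg : IsDensity D fg) (h : ∀ v, fg v = g v * f v) :
    tilt D fg hfg = tilt (tilt D g hg) f hf := by
  refine Subtype.ext ?_
  change (D : Measure ℝ≥0).withDensity _ = ((D : Measure ℝ≥0).withDensity _).withDensity _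
  rw [← withDensity_mul _ hg.measurable.ennreal_ofReal hf.measurable.ennreal_ofReal]
  congr 1
  funext v
  rw [h, ENNReal.ofReal_mul (hg.nonneg v)]
  rfl

lemma isDensity_of_abs_sub_one_le {g : ℝ≥0 → ℝ} (hm : Measurable g) (h : ∀ v, |g v - 1| ≤ 1)
    (h1 : ∫ v, g v ∂(D : Measure ℝ≥0) = 1) : IsDensity D g :=
  ⟨hm, fun v => by linarith [(abs_le.1 (h v)).1], fun v => by linarith [(abs_le.1 (h v)).2], h1⟩

lemma revGap_eq_integral (hD : ∀ᵐ v ∂(D : Measure ℝ≥0), v ≤ 1) (t : PricingAlgorithm) (n : ℕ) :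
    revGap t D n = ∫ S, (opt D - ∫ p, rev D p ∂(t.kernel n S))
      ∂(Measure.pi fun _ : Fin n => (D : Measure ℝ≥0)) := by
  rw [integral_sub (integrable_const _) (integrable_integral_rev hD t n _)]
  simp [revGap, expectedRev]

/-- A distribution with an optimal plateau has two small perturbations, again with optimal plateaus, that
no algorithm can serve simultaneously. -/
lemma HasOptimalPlateau.exists_hard_perturbation (hD : ∀ᵐ v ∂(D : Measure ℝ≥0), v ≤ 1)
    {x y : ℝ≥0} {r : ℝ} (h : HasOptimalPlateau D x y r) :
    ∃ L : ℝ, 0 < L ∧ ∀ ε : ℝ, 0 < ε → L * ε ≤ 1 → ∀ n : ℕ, n * (L * ε) ^ 2 ≤ 1 / 4 →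
      ∀ t : PricingAlgorithm, ∃ (f : ℝ≥0 → ℝ) (hf : IsDensity D f), (∀ v, |f v - 1| ≤ L * ε) ∧
        (∃ x' y' r', HasOptimalPlateau (tilt D f hf) x' y' r') ∧
        3 / 16 * ε ≤ revGap t (tilt D f hf) n := by
  obtain ⟨k, w, L, x₁, y₁, x₂, hkm, hL, hkL, hk0, hkw, hw01, hx1, hxy1, hy1, hx2, hx2y, hw1, hw0⟩ :=
    h.exists_bump
  obtain ⟨hx, hxy, hr, hplat, hmax⟩ := h
  refine ⟨L, hL, fun ε hε hLε n hn t => ?_⟩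
  set μ : Measure ℝ≥0 := (D : Measure ℝ≥0) with hμ
  have hki : Integrable k μ := integrable_of_bounded hkm L hkL
  have hεk : ∀ v, |ε * k v| ≤ L * ε := fun v => by
    rw [abs_mul, abs_of_pos hε, mul_comm]; gcongr; exact hkL v
  have hp : IsDensity D fun v => 1 + ε * k v := by
    refine isDensity_of_abs_sub_one_le ((hkm.const_mul ε).const_add 1) (fun v => ?_) ?_
    · rw [add_sub_cancel_left]; exact (hεk v).trans hLε
    · rw [integral_add (integrable_const _) (hki.const_mul ε), integral_const_mul, hk0]; simp
  have hm : IsDensity D fun v => 1 - ε * k v := by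
    refine isDensity_of_abs_sub_one_le ((hkm.const_mul ε).const_sub 1) (fun v => ?_) ?_
    · rw [sub_sub_cancel_left, abs_neg]; exact (hεk v).trans hLε
    · rw [integral_sub (integrable_const _) (hki.const_mul ε), integral_const_mul, hk0]; simp
  have hrp : ∀ p, rev (tilt D _ hp) p = rev D p + ε * w p := fun p => by
    rw [rev_tilt, integral_add (integrable_const _) (hki.const_mul ε).integrableOn,
      integral_const_mul, ← hkw, rev]
    simp only [integral_const, measureReal_restrict_apply_univ, smul_eq_mul]
    ring
  have hrm : ∀ p, rev (tilt D _ hm) p = rev D p - ε * w p := fun p => by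
    rw [rev_tilt, integral_sub (integrable_const _) (hki.const_mul ε).integrableOn,
      integral_const_mul, ← hkw, rev]
    simp only [integral_const, measureReal_restrict_apply_univ, smul_eq_mul]
    ring
  -- Adding `ε w` lifts the part where `w = 1` to the new maximum, while subtracting it leaves the
  -- part where `w = 0` optimal. Either way a plateau survives for the next perturbation.
  have hplp : HasOptimalPlateau (tilt D _ hp) x₁ y₁ (r + ε) := by
    refine ⟨hx.trans_le hx1, hxy1, by linarith, fun p h1 h2 => ?_, fun p => ?_⟩
    · rw [hrp, hplat p (hx1.trans h1) (h2.trans hy1), hw1 p h1 h2, mul_one]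
    · rw [hrp]
      have := mul_le_mul_of_nonneg_left (hw01 p).2 hε.le
      linarith [hmax p]
  have hplm : HasOptimalPlateau (tilt D _ hm) x₂ y r := by
    refine ⟨hx.trans_le hx2, hx2y, hr, fun p h1 h2 => ?_, fun p => ?_⟩
    · rw [hrm, hplat p (hx2.trans h1) h2, hw0 p h1 h2, mul_zero, sub_zero]
    · rw [hrm]
      have := mul_nonneg hε.le (hw01 p).1
      linarith [hmax p]
  have hDp := tilt_ae hp hD
  have hDm := tilt_ae hm hD
  have hop := hplp.opt_eq hDp
  have hom := hplm.opt_eq hDm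
  have hgap : 3 / 8 * ε ≤ revGap t (tilt D _ hp) n + revGap t (tilt D _ hm) n := by
    rw [revGap_eq_integral hDp, revGap_eq_integral hDm]
    refine two_point_bound (h := fun v => ε * k v) hεk hp hm hn
      ((measurable_integral_rev t n).const_sub _) ((measurable_integral_rev t n).const_sub _)
      (K := r + ε) (fun S => ?_) (fun S => ?_) (fun S => ?_) (fun S => ?_) hε.le fun S => ?_
    · have : ∫ p, rev (tilt D _ hp) p ∂(t.kernel n S) ≤ ∫ _, opt (tilt D _ hp) ∂(t.kernel n S) :=
        integral_mono (integrable_rev hDp _) (integrable_const _) (rev_le_opt hDp)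
      simpa using this
    · have : ∫ p, rev (tilt D _ hm) p ∂(t.kernel n S) ≤ ∫ _, opt (tilt D _ hm) ∂(t.kernel n S) :=
        integral_mono (integrable_rev hDm _) (integrable_const _) (rev_le_opt hDm)
      simpa using this
    · rw [hop]; linarith [integral_rev_nonneg (D := tilt D _ hp) t n S]
    · rw [hom]; linarith [integral_rev_nonneg (D := tilt D _ hm) t n S]
    -- The two revenues of any price sum to `2 * rev D p ≤ 2 * r`, whereas the two optima sum to `2
    -- * r + ε`.
    · have h1 : ∫ p, rev (tilt D _ hp) p ∂(t.kernel n S) + ∫ p, rev (tilt D _ hm) p ∂(t.kernel n S)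
          = ∫ p, 2 * rev D p ∂(t.kernel n S) := by
        rw [← integral_add (integrable_rev hDp _) (integrable_rev hDm _)]
        refine integral_congr_ae (Eventually.of_forall fun p => ?_)
        simp only [hrp, hrm]; ring
      have h2 : ∫ p, 2 * rev D p ∂(t.kernel n S) ≤ ∫ _, 2 * r ∂(t.kernel n S) :=
        integral_mono ((integrable_rev hD _).const_mul 2) (integrable_const _) fun p => by
          have := hmax p; simp only; linarith
      simp only [integral_const, probReal_univ, one_smul] at h2
      rw [hop, hom]
      linarith
  rcases le_total (3 / 16 * ε) (revGap t (tilt D _ hp) n) with h1 | h1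
  · refine ⟨_, hp, fun v => ?_, ⟨_, _, _, hplp⟩, h1⟩
    rw [add_sub_cancel_left]; exact hεk v
  · refine ⟨_, hm, fun v => ?_, ⟨_, _, _, hplm⟩, by linarith⟩
    rw [sub_sub_cancel_left, abs_neg]; exact hεk v

end Perturbation

/-! ### Continuity of the regret in the density -/

section Continuity

variable {D : ValuationDist}

lemma abs_prod_sub_prod_le {ι : Type*} (s : Finset ι) {a b : ι → ℝ} {δ : ℝ} (ha : ∀ i, |a i| ≤ 2)
    (hb : ∀ i, |b i| ≤ 2) (h : ∀ i, |a i - b i| ≤ δ) :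
    |∏ i ∈ s, a i - ∏ i ∈ s, b i| ≤ s.card * 2 ^ s.card * δ := by
  classical
  induction s using Finset.induction_on with
  | empty => simp
  | insert i s hi ih =>
    rw [Finset.prod_insert hi, Finset.prod_insert hi, Finset.card_insert_of_notMem hi]
    have hB : |∏ i ∈ s, b i| ≤ 2 ^ s.card := by
      rw [Finset.abs_prod]
      exact (Finset.prod_le_prod (fun _ _ => abs_nonneg _) fun i _ => hb i).trans (by simp)
    have hδ : 0 ≤ δ := (abs_nonneg _).trans (h i)
    have e : a i * ∏ i ∈ s, a i - b i * ∏ i ∈ s, b i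
        = a i * (∏ i ∈ s, a i - ∏ i ∈ s, b i) + (a i - b i) * ∏ i ∈ s, b i := by ring
    rw [e]
    refine (abs_add_le _ _).trans ?_
    rw [abs_mul, abs_mul]
    have h1 : |a i| * |∏ i ∈ s, a i - ∏ i ∈ s, b i| ≤ 2 * (s.card * 2 ^ s.card * δ) :=
      mul_le_mul (ha i) ih (abs_nonneg _) zero_le_two
    have h2 : |a i - b i| * |∏ i ∈ s, b i| ≤ δ * 2 ^ s.card :=
      mul_le_mul (h i) hB (abs_nonneg _) hδ
    have h3 : 0 ≤ δ * 2 ^ s.card := by positivity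
    push_cast
    rw [pow_succ]
    linarith

lemma abs_integral_le_of_abs_le {Ω : Type*} [MeasurableSpace Ω] {P : Measure Ω}
    [IsProbabilityMeasure P] {f : Ω → ℝ} {c : ℝ} (h : ∀ ω, |f ω| ≤ c) : |∫ ω, f ω ∂P| ≤ c := by
  simpa using norm_integral_le_of_norm_le_const (μ := P) (f := f) (C := c)
    (Eventually.of_forall fun ω => by simpa [Real.norm_eq_abs] using h ω)

lemma abs_rev_tilt_sub_le (hD : ∀ᵐ v ∂(D : Measure ℝ≥0), v ≤ 1) {g g' : ℝ≥0 → ℝ}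
    (hg : IsDensity D g) (hg' : IsDensity D g') {δ : ℝ} (h : ∀ v, |g v - g' v| ≤ δ) (p : ℝ≥0) :
    |rev (tilt D g hg) p - rev (tilt D g' hg') p| ≤ δ := by
  have hδ : 0 ≤ δ := (abs_nonneg _).trans (h 0)
  rcases lt_or_ge 1 p with hp | hp
  · rw [rev_eq_zero (tilt_ae hg hD) hp, rev_eq_zero (tilt_ae hg' hD) hp]
    simpa using hδ
  · rw [rev_tilt, rev_tilt, ← mul_sub, abs_mul, NNReal.abs_eq,
      ← integral_sub hg.integrable.integrableOn hg'.integrable.integrableOn,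
      ← integral_indicator measurableSet_Ici]
    have hp1 : (p : ℝ) ≤ 1 := by exact_mod_cast hp
    have : |∫ v, (Set.Ici p).indicator (fun v => g v - g' v) v ∂(D : Measure ℝ≥0)| ≤ δ :=
      abs_integral_le_of_abs_le fun v => by
        by_cases hv : v ∈ Set.Ici p
        · rw [Set.indicator_of_mem hv]; exact h v
        · rw [Set.indicator_of_notMem hv]; simpa using hδ
    calc _ ≤ 1 * δ := mul_le_mul hp1 this (abs_nonneg _) zero_le_one
      _ = δ := one_mul δ

lemma opt_tilt_le (hD : ∀ᵐ v ∂(D : Measure ℝ≥0), v ≤ 1) {g g' : ℝ≥0 → ℝ}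
    (hg : IsDensity D g) (hg' : IsDensity D g') {δ : ℝ} (h : ∀ v, |g v - g' v| ≤ δ) :
    opt (tilt D g hg) ≤ opt (tilt D g' hg') + δ :=
  opt_le_of_forall fun p => by
    linarith [(abs_le.1 (abs_rev_tilt_sub_le hD hg hg' h p)).2,
      rev_le_opt (tilt_ae hg' hD) p]

/-- For a fixed sample size, the revenue gap is Lipschitz in the density. -/
lemma revGap_tilt_le (hD : ∀ᵐ v ∂(D : Measure ℝ≥0), v ≤ 1) {g g' : ℝ≥0 → ℝ}
    (hg : IsDensity D g) (hg' : IsDensity D g') {δ : ℝ} (h : ∀ v, |g v - g' v| ≤ δ)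
    (t : PricingAlgorithm) (n : ℕ) :
    revGap t (tilt D g hg) n ≤ revGap t (tilt D g' hg') n + (n * 2 ^ n + 2 ^ n + 1) * δ := by
  have hg1 := tilt_ae hg hD
  have hg1' := tilt_ae hg' hD
  set P := Measure.pi fun _ : Fin n => (D : Measure ℝ≥0)
  set F : (Fin n → ℝ≥0) → ℝ := fun S => ∫ p, rev (tilt D g hg) p ∂(t.kernel n S)
  set F' : (Fin n → ℝ≥0) → ℝ := fun S => ∫ p, rev (tilt D g' hg') p ∂(t.kernel n S)
  have hF1 : ∀ S, |F S| ≤ 1 := fun S => by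
    rw [abs_of_nonneg (integral_rev_nonneg t n S)]
    simpa using integral_rev_le hg1 t n S
  have hF1' : ∀ S, |F' S| ≤ 1 := fun S => by
    rw [abs_of_nonneg (integral_rev_nonneg t n S)]
    simpa using integral_rev_le hg1' t n S
  have hFF : ∀ S, |F S - F' S| ≤ δ := fun S => by
    simp only [F, F']
    rw [← integral_sub (integrable_rev hg1 _) (integrable_rev hg1' _)]
    exact abs_integral_le_of_abs_le (abs_rev_tilt_sub_le hD hg hg' h)
  have hint : ∀ {f : ℝ≥0 → ℝ} (hf : IsDensity D f) {G : (Fin n → ℝ≥0) → ℝ}, Measurable G →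
      (∀ S, |G S| ≤ 1) → Integrable (fun S => (∏ i, f (S i)) * G S) P := by
    intro f hf G hG hG1
    refine integrable_of_bounded ((measurable_prod_density hf n).mul hG) (2 ^ n * 1) fun S => ?_
    rw [abs_mul, abs_of_nonneg (prod_density_nonneg hf S)]
    exact mul_le_mul (prod_density_le hf S) (hG1 S) (abs_nonneg _) (by positivity)
  have hE : |expectedRev t (tilt D g hg) n - expectedRev t (tilt D g' hg') n|
      ≤ (n * 2 ^ n + 2 ^ n) * δ := by
    unfold expectedRev
    rw [integral_pi_tilt hg, integral_pi_tilt hg', ← integral_sub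
      (hint hg (measurable_integral_rev t n) hF1) (hint hg' (measurable_integral_rev t n) hF1')]
    refine abs_integral_le_of_abs_le fun S => ?_
    change |(∏ i, g (S i)) * F S - (∏ i, g' (S i)) * F' S| ≤ _
    have e : (∏ i, g (S i)) * F S - (∏ i, g' (S i)) * F' S
        = (∏ i, g (S i) - ∏ i, g' (S i)) * F S + (∏ i, g' (S i)) * (F S - F' S) := by ring
    have h1 : |∏ i, g (S i) - ∏ i, g' (S i)| ≤ n * 2 ^ n * δ := by
      simpa using abs_prod_sub_prod_le Finset.univ (fun i => hg.abs_le (S i))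
        (fun i => hg'.abs_le (S i)) (fun i => h (S i))
    rw [e]
    refine (abs_add_le _ _).trans ?_
    rw [abs_mul, abs_mul, abs_of_nonneg (prod_density_nonneg hg' S)]
    calc _ ≤ n * 2 ^ n * δ * 1 + 2 ^ n * δ := by
          refine add_le_add (mul_le_mul h1 (hF1 S) (abs_nonneg _) ((abs_nonneg _).trans h1)) ?_
          exact mul_le_mul (prod_density_le hg' S) (hFF S) (abs_nonneg _) (by positivity)
      _ = _ := by ring
  have ho := opt_tilt_le hD hg hg' h
  unfold revGap
  linarith [(abs_le.1 hE).1]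

end Continuity

/-! ### The equal-revenue distribution -/

section BaseDistribution

/-- A random variable on the unit interval with `P(V ≥ p) = 1 / (2p)` for `p ∈ [1/2, 1]`. -/
noncomputable def equalRevenueValue (u : unitInterval) : ℝ≥0 :=
  (max 1 (2 * Real.toNNReal u))⁻¹

lemma measurable_equalRevenueValue : Measurable equalRevenueValue := by
  unfold equalRevenueValue
  exact (measurable_const.max (measurable_subtype_coe.real_toNNReal.const_mul 2)).inv

/-- The equal-revenue distribution on `[1/2, 1]`. -/
noncomputable def equalRevenueDist : ValuationDist :=
  ⟨(volume : Measure unitInterval).map equalRevenueValue,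
    Measure.isProbabilityMeasure_map measurable_equalRevenueValue.aemeasurable⟩

lemma equalRevenueDist_le_one : ∀ᵐ v ∂(equalRevenueDist : Measure ℝ≥0), v ≤ 1 := by
  change ∀ᵐ v ∂((volume : Measure unitInterval).map equalRevenueValue), v ≤ 1
  rw [ae_map_iff measurable_equalRevenueValue.aemeasurable measurableSet_Iic]
  exact Eventually.of_forall fun u => inv_le_one_of_one_le₀ (le_max_left _ _)

lemma rev_equalRevenueDist {p : ℝ≥0} (h1 : 1 / 2 ≤ p) (h2 : p ≤ 1) :
    rev equalRevenueDist p = 1 / 2 := by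
  have hp0 : 0 < p := lt_of_lt_of_le (by norm_num) h1
  have hp0' : (0 : ℝ) < p := hp0
  have h1' : (1 / 2 : ℝ) ≤ p := by exact_mod_cast h1
  have hmem : (1 / (2 * p) : ℝ) ∈ unitInterval :=
    ⟨by positivity, by rw [div_le_one (by positivity)]; linarith⟩
  have hpre : equalRevenueValue ⁻¹' Set.Ici p = Set.Iic (⟨1 / (2 * p), hmem⟩ : unitInterval) := by
    ext u
    simp only [Set.mem_preimage, Set.mem_Ici, Set.mem_Iic, equalRevenueValue]
    rw [le_inv_comm₀ hp0 (lt_of_lt_of_le one_pos (le_max_left _ _)), max_le_iff,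
      and_iff_right ((one_le_inv₀ hp0).2 h2), ← Subtype.coe_le_coe, ← NNReal.coe_le_coe]
    push_cast
    rw [Real.coe_toNNReal _ u.2.1, le_div_iff₀ (by positivity), ← one_div, le_div_iff₀ hp0']
    constructor <;> intro h <;> linarith
  have hm : (equalRevenueDist : Measure ℝ≥0).real (Set.Ici p) = 1 / (2 * p) := by
    change ((volume : Measure unitInterval).map equalRevenueValue).real (Set.Ici p) = _
    rw [map_measureReal_apply measurable_equalRevenueValue measurableSet_Ici, hpre, measureReal_def,
      unitInterval.volume_Iic, ENNReal.toReal_ofReal hmem.1]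
  rw [rev, hm]
  field_simp

lemma hasOptimalPlateau_equalRevenueDist : HasOptimalPlateau equalRevenueDist (1 / 2) 1 (1 / 2) := by
  refine ⟨by norm_num, by norm_num, by norm_num, fun p h1 h2 => rev_equalRevenueDist h1 h2, fun p => ?_⟩
  rcases le_total (1 / 2) p with h1 | h1
  · rcases le_or_gt p 1 with h2 | h2
    · exact (rev_equalRevenueDist h1 h2).le
    · rw [rev_eq_zero equalRevenueDist_le_one h2]; norm_num
  · calc rev equalRevenueDist p ≤ p * 1 := mul_le_mul_of_nonneg_left measureReal_le_one p.2
      _ ≤ 1 / 2 := by rw [mul_one]; exact_mod_cast h1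

end BaseDistribution

/-! ### Nested balls of hard densities -/

section LowerBound

variable {D : ValuationDist}

/-- All densities in the uniform ball of radius `ρ > 0` around `g` stay in `[0, 2]`, and the distribution
with density `g` has an optimal plateau. -/
structure PlateauBall (D : ValuationDist) (g : ℝ≥0 → ℝ) (ρ : ℝ) : Prop where
  pos : 0 < ρ
  abs_sub_one_add_le : ∀ v, |g v - 1| + ρ ≤ 1
  isDensity : IsDensity D g
  plateau : ∃ x y r, HasOptimalPlateau (tilt D g isDensity) x y r

/-- The centre is perturbed inside the ball so as to be hard at some `n ≥ m`; the new radius is then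
taken so small that, by continuity of the regret at this fixed `n`, every density of the new ball is
hard there. -/
lemma PlateauBall.exists_hard_ball (hD : ∀ᵐ v ∂(D : Measure ℝ≥0), v ≤ 1) {R : ℕ → ℝ}
    (hR : R =o[atTop] invSqrt) (t : PricingAlgorithm) {g : ℝ≥0 → ℝ} {ρ : ℝ} (h : PlateauBall D g ρ)
    (m : ℕ) :
    ∃ (g' : ℝ≥0 → ℝ) (ρ' : ℝ), PlateauBall D g' ρ' ∧ ρ' ≤ ρ / 2 ∧ (∀ v, |g' v - g v| + ρ' ≤ ρ) ∧
      ∃ n ≥ m, ∀ (f : ℝ≥0 → ℝ) (hf : IsDensity D f), (∀ v, |g' v - f v| ≤ ρ') →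
        R n ≤ revGap t (tilt D f hf) n := by
  obtain ⟨hρ, hball, hg, x, y, r, hplat⟩ := h
  have hDg := tilt_ae hg hD
  obtain ⟨L, hL, hstep⟩ := hplat.exists_hard_perturbation hDg
  -- With `ε = 1 / (2 L √n)` the regret of the new centre is at least `3 / 16 * ε`, twice `3 / 64 /
  -- L / √n`: one half bounds `R n`, and the other pays for moving inside the ball.
  have hc : 0 < 3 / 64 / L := by positivity
  have hev := hR.bound hc
  -- Beyond `N` one has `1 / √n ≤ ρ / 2`, so the perturbed centre moves by at most half the radius.
  obtain ⟨N, hN⟩ := exists_nat_gt ((2 / ρ) ^ 2)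
  obtain ⟨n, hRn, hn⟩ := (hev.and (eventually_ge_atTop (max m (max N 1)))).exists
  have hnm : m ≤ n := (le_max_left _ _).trans hn
  have hnN : N ≤ n := ((le_max_left _ _).trans (le_max_right _ _)).trans hn
  have hn1 : 1 ≤ n := ((le_max_right _ _).trans (le_max_right _ _)).trans hn
  have hn0 : (0 : ℝ) < n := by exact_mod_cast hn1
  set q := √(n : ℝ) with hq
  have hq0 : 0 < q := Real.sqrt_pos.2 hn0
  have hq1 : 1 ≤ q := by rw [hq, Real.one_le_sqrt]; exact_mod_cast hn1
  have hqn : (n : ℝ) = q ^ 2 := (Real.sq_sqrt hn0.le).symm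
  have hqρ : 2 / ρ ≤ q := Real.le_sqrt_of_sq_le (hN.le.trans (by exact_mod_cast hnN))
  have hqρ' : 1 / q ≤ ρ / 2 := by
    rw [div_le_iff₀ hρ] at hqρ
    rw [div_le_div_iff₀ hq0 two_pos]; linarith
  -- The largest size with `n * (L * ε) ^ 2 ≤ 1 / 4`.
  set ε : ℝ := 1 / (2 * L * q) with hε
  have hε0 : 0 < ε := by positivity
  have hLε : L * ε = 1 / (2 * q) := by rw [hε]; field_simp
  have hLε1 : L * ε ≤ 1 := by
    rw [hLε, div_le_one (by positivity)]; linarith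
  obtain ⟨f, hf, hf1, ⟨x', y', r', hpl⟩, hgap⟩ := hstep ε hε0 hLε1 n
    (by rw [hLε, hqn]; apply le_of_eq; field_simp; norm_num) t
  have hdiff : ∀ v, |g v * f v - g v| ≤ ρ / 2 := fun v => by
    have : g v * f v - g v = g v * (f v - 1) := by ring
    rw [this, abs_mul]
    calc |g v| * |f v - 1| ≤ 2 * (L * ε) := mul_le_mul (hg.abs_le v) (hf1 v) (abs_nonneg _) zero_le_two
      _ = 1 / q := by rw [hLε]; field_simp
      _ ≤ ρ / 2 := hqρ'
  have htri : ∀ v, |g v * f v - 1| ≤ |g v * f v - g v| + |g v - 1| := fun v => abs_sub_le _ _ _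
  have hgf : IsDensity D fun v => g v * f v := by
    refine isDensity_of_abs_sub_one_le (hg.measurable.mul hf.measurable) (fun v => ?_) ?_
    · linarith [htri v, hdiff v, hball v]
    · rw [← integral_tilt hg, hf.integral_eq_one]
  have hR' : R n ≤ 3 / 64 / L / q := by
    have h1 : R n ≤ ‖R n‖ := Real.le_norm_self _
    have h2 : ‖invSqrt n‖ = 1 / q := by
      rw [invSqrt_eq, Real.norm_of_nonneg (by positivity)]
    rw [h2] at hRn
    calc R n ≤ 3 / 64 / L * (1 / q) := h1.trans hRn
      _ = _ := by ring
  set K : ℝ := n * 2 ^ n + 2 ^ n + 1 with hK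
  have hK0 : 0 < K := by positivity
  -- The second entry keeps the Lipschitz loss `K * ρ'` within half of the guaranteed regret.
  set ρ' : ℝ := min (ρ / 2) (3 / 64 / L / q / K) with hρ'
  have hρ'0 : 0 < ρ' := lt_min (by linarith) (by positivity)
  have hρ'1 : ρ' ≤ ρ / 2 := min_le_left _ _
  refine ⟨fun v => g v * f v, ρ', ⟨hρ'0, fun v => ?_, hgf, x', y', r', ?_⟩, hρ'1, fun v => ?_, n, hnm,
    fun f' hf' hclose => ?_⟩
  · linarith [htri v, hdiff v, hball v]
  · rw [tilt_tilt hg hf hgf fun _ => rfl]; exact hpl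
  · linarith [hdiff v]
  · have h1 := revGap_tilt_le hD hgf hf' hclose t n
    rw [tilt_tilt hg hf hgf fun _ => rfl] at h1
    have h2 : K * ρ' ≤ 3 / 64 / L / q := by
      calc K * ρ' ≤ K * (3 / 64 / L / q / K) := by gcongr; exact min_le_right _ _
        _ = _ := by field_simp
    have h3 : 3 / 16 * ε = 2 * (3 / 64 / L / q) := by rw [hε]; field_simp; norm_num
    linarith

/-- The centres converge uniformly, and their limit lies in every ball, so it inherits the hardness
built in at each stage. The stages are adapted to `t`, hence so is the limit distribution. -/
theorem notLearnableFasterThan_onUnitInterval {R : ℕ → ℝ} (hR : R =o[atTop] invSqrt) :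
    NotLearnableFasterThan onUnitInterval R := by
  intro t
  set D := equalRevenueDist
  have hD : ∀ᵐ v ∂(D : Measure ℝ≥0), v ≤ 1 := equalRevenueDist_le_one
  have hone : IsDensity D fun _ => 1 :=
    ⟨measurable_const, fun _ => zero_le_one, fun _ => one_le_two, by simp⟩
  have htilt1 : tilt D (fun _ => 1) hone = D := Subtype.ext (by
    change (D : Measure ℝ≥0).withDensity _ = D
    simp)
  have hstart : PlateauBall D (fun _ => 1) 1 :=
    ⟨one_pos, fun _ => by simp, hone, 1 / 2, 1, 1 / 2, by
      rw [htilt1]; exact hasOptimalPlateau_equalRevenueDist⟩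
  let State := {s : (ℝ≥0 → ℝ) × ℝ // PlateauBall D s.1 s.2}
  have hnext : ∀ (m : ℕ) (s : State), ∃ s' : State, s'.1.2 ≤ s.1.2 / 2 ∧
      (∀ v, |s'.1.1 v - s.1.1 v| + s'.1.2 ≤ s.1.2) ∧
      ∃ n ≥ m, ∀ (f : ℝ≥0 → ℝ) (hf : IsDensity D f), (∀ v, |s'.1.1 v - f v| ≤ s'.1.2) →
        R n ≤ revGap t (tilt D f hf) n := by
    intro m s
    obtain ⟨g', ρ', h1, h2⟩ := s.2.exists_hard_ball hD hR t m
    exact ⟨⟨(g', ρ'), h1⟩, h2⟩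
  choose next hn1 hn2 hn3 using hnext
  -- Stage `m` asks for a hard sample size at least `m`, which makes these sizes unbounded.
  let σ : ℕ → State := fun k => Nat.rec ⟨(fun _ => 1, 1), hstart⟩ (fun m s => next m s) k
  let g : ℕ → ℝ≥0 → ℝ := fun k => (σ k).1.1
  let ρ : ℕ → ℝ := fun k => (σ k).1.2
  have hρpos : ∀ k, 0 < ρ k := fun k => (σ k).2.pos
  have hρhalf : ∀ k, ρ k ≤ (1 / 2) ^ k := by
    intro k
    induction k with
    | zero => simp [ρ, σ]
    | succ k ih =>
      have : ρ (k + 1) ≤ ρ k / 2 := hn1 k (σ k)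
      rw [pow_succ]; linarith
  have hnest : ∀ k j, ∀ v, |g (k + j) v - g k v| + ρ (k + j) ≤ ρ k := by
    intro k j v
    induction j with
    | zero => simp
    | succ j ih =>
      have h1 : |g (k + j + 1) v - g (k + j) v| + ρ (k + j + 1) ≤ ρ (k + j) := hn2 (k + j) (σ (k + j)) v
      have h2 := abs_sub_le (g (k + j + 1) v) (g (k + j) v) (g k v)
      change |g (k + j + 1) v - g k v| + ρ (k + j + 1) ≤ ρ k
      linarith
  have hcauchy : ∀ v, CauchySeq fun k => g k v := fun v =>
    cauchySeq_of_le_geometric (1 / 2) 1 (by norm_num) fun k => by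
      rw [dist_comm, Real.dist_eq, one_mul]
      linarith [hnest k 1 v, hρpos (k + 1), hρhalf k]
  choose G hG using fun v => cauchySeq_tendsto_of_complete (hcauchy v)
  have hclose : ∀ k v, |g k v - G v| ≤ ρ k := fun k v => by
    have h1 : Tendsto (fun j => |g k v - g (k + j) v|) atTop (𝓝 |g k v - G v|) := by
      have h2 : Tendsto (fun j => g (k + j) v) atTop (𝓝 (G v)) := by
        simpa [add_comm] using (tendsto_add_atTop_iff_nat k).2 (hG v)
      exact (h2.const_sub _).abs
    refine le_of_tendsto h1 (Eventually.of_forall fun j => ?_)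
    rw [abs_sub_comm]
    linarith [hnest k j v, hρpos (k + j)]
  have hGm : Measurable G := measurable_of_tendsto_metrizable (fun k => (σ k).2.isDensity.measurable)
    (tendsto_pi_nhds.2 hG)
  -- The initial ball has centre `1` and radius `1`, which keeps the limit in `[0, 2]`.
  have hG1 : ∀ v, |G v - 1| ≤ 1 := fun v => by
    rw [abs_sub_comm]; exact hclose 0 v
  have hGi : Integrable G (D : Measure ℝ≥0) := integrable_of_bounded hGm 2 fun v => by
    have := abs_le.1 (hG1 v)
    rw [abs_le]; constructor <;> linarith
  have hGint : ∫ v, G v ∂(D : Measure ℝ≥0) = 1 := by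
    have h1 : ∀ k, |1 - ∫ v, G v ∂(D : Measure ℝ≥0)| ≤ (1 / 2) ^ k := fun k => by
      have e : 1 - ∫ v, G v ∂(D : Measure ℝ≥0) = ∫ v, (g k v - G v) ∂(D : Measure ℝ≥0) := by
        rw [integral_sub (σ k).2.isDensity.integrable hGi, (σ k).2.isDensity.integral_eq_one]
      rw [e]
      exact (abs_integral_le_of_abs_le (hclose k)).trans (hρhalf k)
    have h2 : |1 - ∫ v, G v ∂(D : Measure ℝ≥0)| ≤ 0 :=
      ge_of_tendsto (tendsto_pow_atTop_nhds_zero_of_lt_one (by norm_num) (by norm_num))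
        (Eventually.of_forall h1)
    linarith [abs_eq_zero.1 (le_antisymm h2 (abs_nonneg _))]
  have hGd : IsDensity D G := isDensity_of_abs_sub_one_le hGm hG1 hGint
  -- Both constants can be `1`: the construction already dominates `R n` itself.
  refine ⟨tilt D G hGd, tilt_ae hGd hD, 1, one_pos, 1, one_pos, frequently_atTop.2 fun m => ?_⟩
  obtain ⟨n, hnm, hn⟩ := hn3 m (σ m)
  refine ⟨n, hnm, ?_⟩
  rw [one_mul, one_mul, Nat.floor_natCast]
  exact hn G hGd (hclose (m + 1))

end LowerBound

/-! ### The main theorem -/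

theorem mainTheorem2 :
    LearnableAtOptimalLittleO boundedSupport invSqrt ∧
    ((∃ t : PricingAlgorithm, IsERM t) ∧
      ∀ t : PricingAlgorithm, IsERM t → AchievesLittleO t boundedSupport invSqrt) ∧
    (∀ R : ℕ → ℝ, R =o[atTop] invSqrt → NotLearnableFasterThan onUnitInterval R) := by
  obtain ⟨t₀, ht₀⟩ := exists_isERM
  refine ⟨⟨⟨t₀, ht₀.achievesLittleO⟩, fun R hR t => ?_⟩,
    ⟨⟨t₀, ht₀⟩, fun t ht => ht.achievesLittleO⟩,
    fun R hR => notLearnableFasterThan_onUnitInterval hR⟩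
  obtain ⟨D, hD, h⟩ := notLearnableFasterThan_onUnitInterval hR t
  exact ⟨D, ⟨1, hD⟩, h⟩
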